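/- All graphs are finite and simple. The maximum 2-edge-colorable subgraph problem asks, given a graph $G=(V,E)$, to find a subgraph $H$ of $G$ that is 2-edge-colorable (its edges can be colored with two colors so that adjacent edges receive different colors) and has the maximum number of edges among all such subgraphs, together with a 2-edge-coloring of $H$. For a connected graph $G$, let $\mathrm{MaxLeaf}(G)$ be the maximum number of leaves (vertices of degree one) of a spanning tree of $G$. Algorithms are programs of a random access machine with addition and truncated subtraction as arithmetic operations, every elementary operation counting as one step; a graph is given by its number of vertices and its adjacency matrix, and $\mathrm{size}$ is the length of this input. Then the following hold. (1) On connected graphs, the maximum 2-edge-colorable subgraph problem is fixed-parameter tractable with respect to $\mathrm{MaxLeaf}(G)$: there are a computable function $f:\mathbb{N}\to\mathbb{N}$, a polynomial $p$ and an algorithm that solves the problem on every connected graph $G$ in at most $f(\mathrm{MaxLeaf}(G))\cdot p(\mathrm{size})$ steps. In fact one can take $f(k)=2^{(k+1)^2}$ (with a suitable polynomial $p$ and algorithm). (2) There are a polynomial $p$ and an algorithm that solves the problem in at most $p(\mathrm{size})$ steps on every connected graph $G=(V,E)$ with $|E|\le |V|+\log_2|V|$. (3) Every connected graph $G=(V,E)$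 with $|E|>|V|+\log_2|V|$ satisfies $|V|<2^{(\mathrm{MaxLeaf}(G)+1)^2/2}$. -/

import Mathlib

namespace RAM

/-- Arithmetic expressions of the random access machine. `var x` is the register numbered `x`,
`load a` is the content of the memory cell whose address is the value of `a`, and `sub` is
truncated subtraction of natural numbers. There is no multiplication. -/
inductive Expr where
  | const (c : ℕ) : Expr
  | var (x : ℕ) : Expr
  | load (a : Expr) : Expr
  | add (a b : Expr) : Expr
  | sub (a b : Expr) : Expr

/-- Structured programs of the random access machine. A condition holds when its value is
nonzero. -/
inductive Cmd where
  | skip : Cmd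
  | assign (x : ℕ) (e : Expr) : Cmd
  | store (a e : Expr) : Cmd
  | seq (c d : Cmd) : Cmd
  | ite (b : Expr) (c d : Cmd) : Cmd
  | loop (b : Expr) (c : Cmd) : Cmd

/-- A configuration: the contents of the registers and of the memory cells. -/
structure State where
  reg : ℕ → ℕ
  mem : ℕ → ℕ

/-- The value of an expression. -/
def Expr.eval (s : State) : Expr → ℕ
  | const c => c
  | var x => s.reg x
  | load a => s.mem (a.eval s)
  | add a b => a.eval s + b.eval s
  | sub a b => a.eval s - b.eval s

/-- The number of elementary operations used to evaluate an expression. -/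
def Expr.cost : Expr → ℕ
  | const _ => 1
  | var _ => 1
  | load a => a.cost + 1
  | add a b => a.cost + b.cost + 1
  | sub a b => a.cost + b.cost + 1

/-- `Exec c s s' t`: started in the configuration `s`, the program `c` halts in the configuration
`s'` after exactly `t` elementary steps. -/
inductive Exec : Cmd → State → State → ℕ → Prop where
  | skip (s : State) : Exec Cmd.skip s s 1
  | assign (s : State) (x : ℕ) (e : Expr) :
      Exec (Cmd.assign x e) s ⟨Function.update s.reg x (e.eval s), s.mem⟩ (e.cost + 1)
  | store (s : State) (a e : Expr) :
      Exec (Cmd.store a e) s ⟨s.reg, Function.update s.mem (a.eval s) (e.eval s)⟩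
        (a.cost + e.cost + 1)
  | seq {c d : Cmd} {s₁ s₂ s₃ : State} {t₁ t₂ : ℕ} :
      Exec c s₁ s₂ t₁ → Exec d s₂ s₃ t₂ → Exec (Cmd.seq c d) s₁ s₃ (t₁ + t₂)
  | ite_true {b : Expr} {c d : Cmd} {s s' : State} {t : ℕ} :
      b.eval s ≠ 0 → Exec c s s' t → Exec (Cmd.ite b c d) s s' (b.cost + 1 + t)
  | ite_false {b : Expr} {c d : Cmd} {s s' : State} {t : ℕ} :
      b.eval s = 0 → Exec d s s' t → Exec (Cmd.ite b c d) s s' (b.cost + 1 + t)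
  | loop_stop {b : Expr} {c : Cmd} {s : State} :
      b.eval s = 0 → Exec (Cmd.loop b c) s s (b.cost + 1)
  | loop_step {b : Expr} {c : Cmd} {s₁ s₂ s₃ : State} {t₁ t₂ : ℕ} :
      b.eval s₁ ≠ 0 → Exec c s₁ s₂ t₁ → Exec (Cmd.loop b c) s₂ s₃ t₂ →
        Exec (Cmd.loop b c) s₁ s₃ (b.cost + 1 + t₁ + t₂)

end RAM

namespace MaxTwoEdgeCol

/-- A graph is `k`-edge-colorable if its edges can be colored with `k` colors so that adjacent
edges receive different colors. -/
def EdgeColorable {V : Type*} (H : SimpleGraph V) (k : ℕ) : Prop :=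
  H.lineGraph.Colorable k

/-- `H` is a maximum `k`-edge-colorable subgraph of `G`. -/
def IsMaxEdgeColorable {V : Type*} (G H : SimpleGraph V) (k : ℕ) : Prop :=
  H ≤ G ∧ EdgeColorable H k ∧
    ∀ H' : SimpleGraph V, H' ≤ G → EdgeColorable H' k → H'.edgeSet.ncard ≤ H.edgeSet.ncard

/-- The number of leaves (vertices of degree one) of `T`. -/
noncomputable def numLeaves {V : Type*} (T : SimpleGraph V) : ℕ :=
  {v : V | (T.neighborSet v).ncard = 1}.ncard

/-- The maximum number of leaves of a spanning tree of a (finite, connected) graph. -/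
noncomputable def maxLeaf {V : Type*} (G : SimpleGraph V) : ℕ :=
  sSup {l : ℕ | ∃ T : SimpleGraph V, T ≤ G ∧ T.IsTree ∧ numLeaves T = l}

open Classical in
/-- The initial configuration on input `G`: register `0` contains the number `n` of vertices, the
memory cells `0, …, n * n - 1` contain the adjacency matrix of `G`, row by row, and every other
register and cell contains `0`. -/
noncomputable def initState {n : ℕ} (G : SimpleGraph (Fin n)) : RAM.State where
  reg x := if x = 0 then n else 0
  mem a := if ∃ i j : Fin n, a = (i : ℕ) * n + j ∧ G.Adj i j then 1 else 0

/-- The number of words of the input that describes a graph with `n` vertices. -/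
def inputSize (n : ℕ) : ℕ := n * n + 1

open Classical in
/-- The memory of `s` describes the subgraph `H` together with the proper edge-coloring `C` of `H`
with the two colors `1` and `2`: the entry at `(i, j)` of the `n × n` matrix stored in the cells
`0, …, n * n - 1` is the color of `ij` if `ij` is an edge of `H`, and `0` otherwise. -/
def Describes {n : ℕ} (s : RAM.State) (H : SimpleGraph (Fin n))
    (C : H.lineGraph.Coloring (Fin 2)) : Prop :=
  ∀ i j : Fin n, s.mem ((i : ℕ) * n + j) =
    if h : H.Adj i j then (C ⟨s(i, j), h⟩ : ℕ) + 1 else 0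

/-- On input `G`, the program `c` halts after at most `T` steps and outputs a maximum
2-edge-colorable subgraph of `G` together with a 2-edge-coloring of it. -/
def SolvesWithin (c : RAM.Cmd) {n : ℕ} (G : SimpleGraph (Fin n)) (T : ℕ) : Prop :=
  ∃ (s : RAM.State) (t : ℕ), RAM.Exec c (initState G) s t ∧ t ≤ T ∧
    ∃ (H : SimpleGraph (Fin n)) (C : H.lineGraph.Coloring (Fin 2)),
      IsMaxEdgeColorable G H 2 ∧ Describes s H C

/-- A graph parameter, evaluated on the graphs with vertex set `{0, …, n - 1}`. -/
abbrev Parameter : Type := (n : ℕ) → SimpleGraph (Fin n) → ℕ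

/-- The maximum 2-edge-colorable subgraph problem can be solved on all connected graphs in time
`f(κ(G)) · poly(size)`. -/
def SolvableInParamTime (κ : Parameter) (f : ℕ → ℕ) : Prop :=
  ∃ (c : RAM.Cmd) (p : Polynomial ℕ), ∀ (n : ℕ) (G : SimpleGraph (Fin n)), G.Connected →
    SolvesWithin c G (f (κ n G) * p.eval (inputSize n))

/-- The maximum 2-edge-colorable subgraph problem, on connected graphs, is fixed-parameter
tractable with respect to the parameter `κ`. -/
def IsFPT (κ : Parameter) : Prop :=
  ∃ f : ℕ → ℕ, Computable f ∧ SolvableInParamTime κ f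

/-- The maximum 2-edge-colorable subgraph problem can be solved in polynomial time on the class
`P` of graphs. -/
def SolvableInPolyTime (P : (n : ℕ) → SimpleGraph (Fin n) → Prop) : Prop :=
  ∃ (c : RAM.Cmd) (p : Polynomial ℕ), ∀ (n : ℕ) (G : SimpleGraph (Fin n)), P n G →
    SolvesWithin c G (p.eval (inputSize n))

end MaxTwoEdgeCol

namespace MaxTwoEdgeCol

open Finset in
/-- A partial spanning tree of `G`: the graph `F` connects the vertices in `S`, the vertices in `L`
are leaves of it, the other vertices in `S` have all their neighbors in `S`. The last field bounds
the number of edges of `G` inside `S`. -/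
structure LeafyPart {V : Type*} [Fintype V] (G : SimpleGraph V) (S L : Finset V)
    (F : SimpleGraph V) : Prop where
  sub : L ⊆ S
  closed : ∀ a ∈ S, a ∉ L → ∀ b, G.Adj a b → b ∈ S
  le : F ≤ G
  supp : ∀ a b, F.Adj a b → a ∈ S
  conn : ∀ a ∈ S, ∀ b ∈ S, F.Reachable a b
  leaf : ∀ a ∈ L, ∀ b c, F.Adj a b → F.Adj a c → b = c
  count : open Classical in
    ∑ a ∈ S, #{b ∈ S | G.Adj a b} + 2 + #L ≤
      2 * #S + #L * #L + 2 * #{a ∈ L | ∀ b, G.Adj a b → b ∈ S}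

section
open Finset Classical

lemma LeafyPart.singleton {V : Type*} [Fintype V] (G : SimpleGraph V) (r : V) :
    LeafyPart G {r} {r} ⊥ where
  sub := le_rfl
  closed a ha hb := absurd ha hb
  le := bot_le
  supp a b h := h.elim
  conn a ha b hb := by
    rw [mem_singleton.1 ha, mem_singleton.1 hb]
  leaf a ha b c h := h.elim
  count := by simp [Finset.filter_singleton]

lemma sum_card_filter_union {V : Type*} (G : SimpleGraph V) {S Y : Finset V}
    (h : Disjoint S Y) :
    ∑ a ∈ S ∪ Y, #{b ∈ S ∪ Y | G.Adj a b} =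
      ∑ a ∈ S, #{b ∈ S | G.Adj a b} + 2 * ∑ a ∈ S, #{b ∈ Y | G.Adj a b}
        + ∑ a ∈ Y, #{b ∈ Y | G.Adj a b} := by
  have key : ∀ a, #{b ∈ S ∪ Y | G.Adj a b} = #{b ∈ S | G.Adj a b} + #{b ∈ Y | G.Adj a b} := by
    intro a
    rw [filter_union, card_union_of_disjoint (disjoint_filter_filter h)]
  have sw : ∑ a ∈ Y, #{b ∈ S | G.Adj a b} = ∑ a ∈ S, #{b ∈ Y | G.Adj a b} := by
    have := sum_card_bipartiteAbove_eq_sum_card_bipartiteBelow (s := Y) (t := S) G.Adj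
    simpa [bipartiteAbove, bipartiteBelow, G.adj_comm] using this
  rw [sum_union h]
  simp only [key, sum_add_distrib, sw]
  ring

lemma LeafyPart.extend {V : Type*} [Fintype V] {G : SimpleGraph V} (hG : G.Connected)
    {S L : Finset V} {F : SimpleGraph V} (h : LeafyPart G S L F) (hne : S.Nonempty)
    (hS : S ≠ univ) : ∃ S' L' F', LeafyPart G S' L' F' ∧ #S < #S' := by
  obtain ⟨x₀, hx₀, b₀, hb₀, hadj₀⟩ : ∃ x ∈ L, ∃ b, b ∉ S ∧ G.Adj x b := by
    obtain ⟨u, hu⟩ := hne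
    obtain ⟨v, hv⟩ : ∃ v, v ∉ S := by
      by_contra! hc
      exact hS (eq_univ_iff_forall.2 hc)
    obtain ⟨p⟩ := hG.preconnected u v
    obtain ⟨d, -, h1, h2⟩ := p.exists_boundary_dart (S : Set V) hu hv
    refine ⟨d.fst, ?_, d.snd, h2, d.adj⟩
    by_contra hc
    exact h2 (h.closed _ h1 hc _ d.adj)
  let out : V → Finset V := fun a => {b | G.Adj a b ∧ b ∉ S}
  have hout : ∀ a b, b ∈ out a ↔ G.Adj a b ∧ b ∉ S := by simp [out]
  obtain ⟨x, hx, hmax⟩ := exists_max_image L (fun a => #(out a)) ⟨x₀, hx₀⟩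
  set Y := out x with hY
  have hYpos : 0 < #Y := lt_of_lt_of_le (card_pos.2 ⟨b₀, (hout _ _).2 ⟨hadj₀, hb₀⟩⟩) (hmax x₀ hx₀)
  have hxS : x ∈ S := h.sub hx
  have hdis : Disjoint S Y := by
    rw [disjoint_left]
    intro a ha hb
    exact ((hout _ _).1 hb).2 ha
  have hdisL : Disjoint (L.erase x) Y :=
    hdis.mono_left ((erase_subset _ _).trans h.sub)
  refine ⟨S ∪ Y, L.erase x ∪ Y, F ⊔ SimpleGraph.fromRel (fun a b => a = x ∧ b ∈ Y), ?_, ?_⟩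
  swap
  · rw [card_union_of_disjoint hdis]
    omega
  have hF' : ∀ a b, (F ⊔ SimpleGraph.fromRel (fun a b => a = x ∧ b ∈ Y)).Adj a b ↔
      F.Adj a b ∨ a ≠ b ∧ (a = x ∧ b ∈ Y ∨ b = x ∧ a ∈ Y) := by
    intro a b
    simp [SimpleGraph.sup_adj, SimpleGraph.fromRel_adj]
  constructor
  · exact union_subset_union ((erase_subset _ _).trans h.sub) le_rfl
  · intro a ha hb b hab
    rcases mem_union.1 ha with ha | ha
    · by_cases hax : a = x
      · by_cases hbS : b ∈ S
        · exact mem_union_left _ hbS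
        · exact mem_union_right _ ((hout _ _).2 ⟨hax ▸ hab, hbS⟩)
      · refine mem_union_left _ (h.closed a ha (fun hc => hb ?_) b hab)
        exact mem_union_left _ (mem_erase.2 ⟨hax, hc⟩)
    · exact absurd (mem_union_right _ ha) hb
  · intro a b hab
    rcases (hF' a b).1 hab with h1 | ⟨-, ⟨rfl, h1⟩ | ⟨rfl, h1⟩⟩
    · exact h.le h1
    · exact ((hout _ _).1 h1).1
    · exact ((hout _ _).1 h1).1.symm
  · intro a b hab
    rcases (hF' a b).1 hab with h1 | ⟨-, ⟨rfl, h1⟩ | ⟨rfl, h1⟩⟩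
    · exact mem_union_left _ (h.supp _ _ h1)
    · exact mem_union_left _ hxS
    · exact mem_union_right _ h1
  · have hr : ∀ a ∈ S ∪ Y,
        (F ⊔ SimpleGraph.fromRel (fun a b => a = x ∧ b ∈ Y)).Reachable a x := by
      intro a ha
      rcases mem_union.1 ha with ha | ha
      · exact (h.conn a ha x hxS).mono le_sup_left
      · refine SimpleGraph.Adj.reachable ((hF' _ _).2 (Or.inr ⟨?_, Or.inr ⟨rfl, ha⟩⟩))
        rintro rfl
        exact disjoint_left.1 hdis hxS ha
    intro a ha b hb
    exact (hr a ha).trans (hr b hb).symm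
  · intro a ha b c hab hac
    rw [hF'] at hab hac
    rcases mem_union.1 ha with ha | ha
    · have haL := mem_of_mem_erase ha
      have hax := ne_of_mem_erase ha
      have haY : a ∉ Y := disjoint_left.1 hdis (h.sub haL)
      simp only [hax, haY, false_and, and_false, or_false] at hab hac
      exact h.leaf a haL b c hab hac
    · have haS : a ∉ S := disjoint_right.1 hdis ha
      have hax : a ≠ x := by rintro rfl; exact haS hxS
      have h1 : ∀ b, ¬ F.Adj a b := fun b hb => haS (h.supp _ _ hb)
      simp only [hax, h1, false_and, false_or] at hab hac
      rw [hab.2.1, hac.2.1]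
  · have hE := sum_card_filter_union G hdis
    have hYY : ∑ a ∈ Y, #{b ∈ Y | G.Adj a b} ≤ #Y * (#Y - 1) := by
      rw [← smul_eq_mul]
      refine sum_le_card_nsmul _ _ _ fun a ha => ?_
      rw [← card_erase_of_mem ha]
      refine card_le_card fun b hb => ?_
      rw [mem_filter] at hb
      exact mem_erase.2 ⟨hb.2.ne', hb.1⟩
    set dead : Finset V := {a ∈ L | ∀ b, G.Adj a b → b ∈ S} with hdead
    set full : Finset V := {a ∈ L.erase x | Y ⊆ out a} with hfull
    set dead' : Finset V := {a ∈ L.erase x ∪ Y | ∀ b, G.Adj a b → b ∈ S ∪ Y} with hdead'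
    have hfd : Disjoint dead full := by
      rw [disjoint_left]
      intro a ha hb
      rw [hdead, mem_filter] at ha
      rw [hfull, mem_filter] at hb
      obtain ⟨y, hy⟩ := card_pos.1 hYpos
      have := (hout _ _).1 (hb.2 hy)
      exact this.2 (ha.2 _ this.1)
    have hsub : dead ∪ full ⊆ dead' := by
      intro a ha'
      rw [hdead', mem_filter]
      rcases mem_union.1 ha' with ha | ha
      · rw [hdead, mem_filter] at ha
        refine ⟨mem_union_left _ (mem_erase.2 ⟨?_, ha.1⟩), fun b hb =>
          mem_union_left _ (ha.2 b hb)⟩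
        rintro rfl
        obtain ⟨y, hy⟩ := card_pos.1 hYpos
        have := (hout _ _).1 hy
        exact this.2 (ha.2 _ this.1)
      · rw [hfull, mem_filter] at ha
        refine ⟨mem_union_left _ ha.1, fun b hb => ?_⟩
        have heq : Y = out a := eq_of_subset_of_card_le ha.2 (hmax a (mem_of_mem_erase ha.1))
        by_cases hbS : b ∈ S
        · exact mem_union_left _ hbS
        · exact mem_union_right _ (heq ▸ (hout _ _).2 ⟨hb, hbS⟩)
    have hD := card_le_card hsub
    rw [card_union_of_disjoint hfd] at hD
    have hSY : ∑ a ∈ S, #{b ∈ Y | G.Adj a b} ≤ #Y + ((#L - 1) * (#Y - 1) + #full) := by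
      have h1 : ∑ a ∈ S, #{b ∈ Y | G.Adj a b} = ∑ a ∈ L, #{b ∈ Y | G.Adj a b} := by
        symm
        refine sum_subset h.sub fun a ha hb => ?_
        rw [card_eq_zero, filter_eq_empty_iff]
        intro b hbY hab
        exact disjoint_right.1 hdis hbY (h.closed a ha hb b hab)
      rw [h1, ← add_sum_erase _ _ hx]
      refine add_le_add (card_le_card (filter_subset _ _)) ?_
      have h2 : ∀ a ∈ L.erase x, #{b ∈ Y | G.Adj a b} ≤
          (#Y - 1) + if Y ⊆ out a then 1 else 0 := by
        intro a ha
        split_ifs with hc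
        · have := card_le_card (filter_subset (fun b => G.Adj a b) Y)
          omega
        · obtain ⟨y, hy, hya⟩ := not_subset.1 hc
          rw [add_zero, ← card_erase_of_mem hy]
          refine card_le_card fun b hb => ?_
          rw [mem_filter] at hb
          refine mem_erase.2 ⟨?_, hb.1⟩
          rintro rfl
          exact hya ((hout _ _).2 ⟨hb.2, disjoint_right.1 hdis hy⟩)
      refine (sum_le_sum h2).trans ?_
      rw [sum_add_distrib, sum_const, card_erase_of_mem hx, ← card_filter, smul_eq_mul]
    have hc := h.count
    rw [hE, card_union_of_disjoint hdis, card_union_of_disjoint hdisL, card_erase_of_mem hx]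
    have hLpos : 0 < #L := card_pos.2 ⟨x, hx⟩
    obtain ⟨l, hl⟩ : ∃ l, #L = l + 1 := ⟨#L - 1, by omega⟩
    obtain ⟨d, hd⟩ : ∃ d, #Y = d + 1 := ⟨#Y - 1, by omega⟩
    rw [hl] at hc hSY ⊢
    rw [hd] at hSY hYY ⊢
    simp only [Nat.add_sub_cancel] at *
    nlinarith

lemma LeafyPart.exists_univ {V : Type*} [Fintype V] {G : SimpleGraph V} (hG : G.Connected) :
    ∃ L F, LeafyPart G univ L F := by
  suffices H : ∀ k : ℕ, ∀ S L F, LeafyPart G S L F → S.Nonempty → Fintype.card V - #S = k →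
      ∃ L F, LeafyPart G univ L F by
    obtain ⟨r⟩ := hG.nonempty
    exact H _ _ _ _ (LeafyPart.singleton G r) (singleton_nonempty r) rfl
  intro k
  induction k using Nat.strong_induction_on with
  | _ k ih =>
    intro S L F h hne hk
    by_cases hS : S = univ
    · exact ⟨L, F, hS ▸ h⟩
    · obtain ⟨S', L', F', h', hlt⟩ := h.extend hG hne hS
      have := card_le_univ S'
      exact ih _ (by omega) S' L' F' h' (card_pos.1 (by omega)) rfl

lemma le_maxLeaf {V : Type*} [Fintype V] {G T : SimpleGraph V} (h : T ≤ G) (hT : T.IsTree) :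
    numLeaves T ≤ maxLeaf G := by
  refine le_csSup ⟨Nat.card V, ?_⟩ ⟨T, h, hT, rfl⟩
  rintro l ⟨T', -, -, rfl⟩
  exact Set.ncard_le_card _

/-- A connected graph all of whose spanning trees have at most `k` leaves has at most
`k (k + 1) / 2` edges outside a spanning tree. -/
theorem two_mul_card_edges_le {V : Type*} [Fintype V] {G : SimpleGraph V} (hG : G.Connected)
    (hV : 1 < Fintype.card V) :
    2 * G.edgeSet.ncard + 2 ≤ 2 * Fintype.card V + maxLeaf G * (maxLeaf G + 1) := by
  obtain ⟨L, F, h⟩ := LeafyPart.exists_univ hG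
  have : Nontrivial V := Fintype.one_lt_card_iff_nontrivial.1 hV
  have hF : F.Connected := ⟨fun a b => h.conn a (mem_univ _) b (mem_univ _)⟩
  obtain ⟨T, hTF, hT⟩ := hF.exists_isTree_le
  have hL : #L ≤ maxLeaf G := by
    refine le_trans ?_ (le_maxLeaf (hTF.trans h.le) hT)
    rw [← Set.ncard_coe_finset L]
    refine Set.ncard_le_ncard (fun a ha => ?_) (Set.toFinite _)
    obtain ⟨b, hb⟩ := hT.connected.preconnected.exists_adj_of_nontrivial a
    rw [Set.mem_ofPred_eq, Set.ncard_eq_one]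
    refine ⟨b, Set.eq_singleton_iff_unique_mem.2 ⟨hb, fun c hc => ?_⟩⟩
    exact h.leaf a ha c b (hTF hc) (hTF hb)
  have hc := h.count
  have hm : ∑ a ∈ (univ : Finset V), #{b ∈ (univ : Finset V) | G.Adj a b} =
      2 * G.edgeSet.ncard := by
    rw [← SimpleGraph.coe_edgeFinset, Set.ncard_coe_finset,
      ← G.sum_degrees_eq_twice_card_edges]
    refine sum_congr rfl fun a _ => ?_
    rw [← SimpleGraph.card_neighborFinset_eq_degree, SimpleGraph.neighborFinset_eq_filter]
  rw [hm, card_univ] at hc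
  have hle := card_filter_le L (fun a => ∀ b, G.Adj a b → b ∈ (univ : Finset V))
  nlinarith

end

lemma two_mul_card_edges_lt {n : ℕ} {G : SimpleGraph (Fin n)} (hG : G.Connected) :
    2 * G.edgeSet.ncard < 2 * n + (maxLeaf G + 1) ^ 2 := by
  rcases Nat.lt_or_ge 1 n with h | h
  · have := two_mul_card_edges_le hG (by simpa using h)
    rw [Fintype.card_fin] at this
    nlinarith
  · have : G.edgeSet = ∅ := by
      rw [SimpleGraph.edgeSet_eq_empty]
      ext a b
      have : a = b := Fin.ext (by omega)
      simp [this]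
    rw [this, Set.ncard_empty]
    positivity

lemma card_lt_two_rpow {n : ℕ} {G : SimpleGraph (Fin n)} (hG : G.Connected)
    (h : (n : ℝ) + Real.logb 2 (n : ℝ) < (G.edgeSet.ncard : ℝ)) :
    (n : ℝ) < (2 : ℝ) ^ (((maxLeaf G : ℝ) + 1) ^ 2 / 2) := by
  obtain ⟨v⟩ := hG.nonempty
  have hn : (0 : ℝ) < n := by exact_mod_cast v.pos
  rw [← Real.logb_lt_iff_lt_rpow one_lt_two hn]
  have := two_mul_card_edges_lt hG
  have h2 : (2 * G.edgeSet.ncard : ℝ) < 2 * n + (maxLeaf G + 1) ^ 2 := by exact_mod_cast this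
  linarith

end MaxTwoEdgeCol

namespace MaxTwoEdgeCol

open Finset Function

/-- The edges numbered `i` and `j` have a common endpoint; the endpoints of the edge numbered `i`
are `eu i` and `ev i`. -/
def Share (eu ev : ℕ → ℕ) (i j : ℕ) : Prop :=
  eu i = eu j ∨ eu i = ev j ∨ ev i = eu j ∨ ev i = ev j

/-- `C` is a partial proper coloring of the edges in `P`, where `0` means uncolored. -/
structure Proper (eu ev : ℕ → ℕ) (P : Finset ℕ) (C : ℕ → ℕ) : Prop where
  le : ∀ i ∈ P, C i ≤ 2
  ne : ∀ i ∈ P, ∀ j ∈ P, i ≠ j → Share eu ev i j → C i = C j → C i = 0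

/-- The number of colored edges in `P`. -/
def numColored (P : Finset ℕ) (C : ℕ → ℕ) : ℕ := #{i ∈ P | C i ≠ 0}

/-- The flag `fr (4 * w + x)` tells whether the color `x` is free at the vertex `w`, with respect
to the coloring `col` of the edges in `P`, `val` of which are colored. -/
structure Partial (n : ℕ) (eu ev : ℕ → ℕ) (P : Finset ℕ) (fr col : ℕ → ℕ) (val : ℕ) : Prop where
  flag_le : ∀ w < n, ∀ x ≤ 2, fr (4 * w + x) ≤ 1
  zero : ∀ w < n, fr (4 * w) = 0
  flag : ∀ w < n, ∀ x ≤ 2, x ≠ 0 →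
    (fr (4 * w + x) = 0 ↔ ∃ i ∈ P, (eu i = w ∨ ev i = w) ∧ col i = x)
  proper : Proper eu ev P col
  val_eq : val = numColored P col

lemma numColored_insert {P : Finset ℕ} {col : ℕ → ℕ} {k x : ℕ} (hk : k ∉ P) :
    numColored (insert k P) (update col k x) = numColored P col + if x = 0 then 0 else 1 := by
  have h : ∀ i ∈ P, (update col k x i ≠ 0 ↔ col i ≠ 0) := by
    intro i hi
    rw [update_of_ne (by rintro rfl; exact hk hi)]
  unfold numColored
  rw [filter_insert, filter_congr h]
  split_ifs with h1 h2 h2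
  · simp_all
  · rw [card_insert_of_notMem (by simp [hk])]
  · rfl
  · simp_all

section
variable {n : ℕ} {eu ev : ℕ → ℕ} {P : Finset ℕ} {fr col : ℕ → ℕ} {val : ℕ}

lemma Share.symm {i j : ℕ} (h : Share eu ev i j) : Share eu ev j i := by
  unfold Share at *
  omega

lemma Proper.insert {k x : ℕ} (h : Proper eu ev P col) (hk : k ∉ P) (hx : x ≤ 2)
    (hx' : x = 0 ∨ ∀ i ∈ P, Share eu ev i k → col i ≠ x) :
    Proper eu ev (insert k P) (update col k x) := by
  have hne : ∀ i ∈ P, update col k x i = col i := fun i hi =>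
    update_of_ne (by rintro rfl; exact hk hi) _ _
  constructor
  · intro i hi
    rcases mem_insert.1 hi with rfl | hi
    · simpa
    · rw [hne i hi]
      exact h.le i hi
  · intro i hi' j hj' hij hs he
    rcases mem_insert.1 hi' with rfl | hi <;> rcases mem_insert.1 hj' with rfl | hj
    · exact absurd rfl hij
    · rw [hne j hj, update_self] at he
      rw [update_self]
      exact hx'.resolve_right fun hc => hc j hj hs.symm he.symm
    · rw [hne i hi, update_self] at he
      rw [hne i hi, he]
      exact hx'.resolve_right fun hc => hc i hi hs he
    · rw [hne i hi] at he ⊢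
      rw [hne j hj] at he
      exact h.ne i hi j hj hij hs he

lemma Proper.mono {Q : Finset ℕ} (h : Proper eu ev P col) (hQ : Q ⊆ P) : Proper eu ev Q col :=
  ⟨fun i hi => h.le i (hQ hi), fun i hi j hj => h.ne i (hQ hi) j (hQ hj)⟩

lemma Partial.skip {k : ℕ} (h : Partial n eu ev P fr col val) (hk : k ∉ P) :
    Partial n eu ev (insert k P) fr (update col k 0) val where
  flag_le := h.flag_le
  zero := h.zero
  flag w hw x hx hx0 := by
    rw [h.flag w hw x hx hx0]
    constructor
    · rintro ⟨i, hi, h1, h2⟩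
      refine ⟨i, mem_insert_of_mem hi, h1, ?_⟩
      rwa [update_of_ne (by rintro rfl; exact hk hi)]
    · rintro ⟨i, hi', h1, h2⟩
      rcases mem_insert.1 hi' with rfl | hi
      · rw [update_self] at h2
        exact absurd h2.symm hx0
      · rw [update_of_ne (by rintro rfl; exact hk hi)] at h2
        exact ⟨i, hi, h1, h2⟩
  proper := h.proper.insert hk (Nat.zero_le _) (Or.inl rfl)
  val_eq := by rw [numColored_insert hk, if_pos rfl, add_zero, h.val_eq]

lemma Partial.color {k x : ℕ} (h : Partial n eu ev P fr col val) (hk : k ∉ P) (hu : eu k < n)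
    (hv : ev k < n) (hx : x ≤ 2) (h1 : fr (4 * eu k + x) ≠ 0) (h2 : fr (4 * ev k + x) ≠ 0) :
    Partial n eu ev (insert k P) (update (update fr (4 * eu k + x) 0) (4 * ev k + x) 0)
      (update col k x) (val + 1) := by
  have hx0 : x ≠ 0 := by
    rintro rfl
    exact h1 (h.zero _ hu)
  refine ⟨fun w hw y hy => ?_, fun w hw => ?_, fun w hw y hy hy0 => ?_,
    h.proper.insert hk hx (Or.inr fun i hi hs hc => ?_), ?_⟩
  · have := h.flag_le w hw y hy
    simp only [update_apply]
    split_ifs <;> omega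
  · have := h.zero w hw
    simp only [update_apply]
    split_ifs <;> omega
  · have hf := h.flag w hw y hy hy0
    have hcol : ∀ i ∈ P, update col k x i = col i := fun i hi =>
      update_of_ne (by rintro rfl; exact hk hi) _ _
    by_cases hk' : (eu k = w ∨ ev k = w) ∧ x = y
    · refine iff_of_true ?_ ⟨k, mem_insert_self _ _, hk'.1, by rw [update_self, hk'.2]⟩
      simp only [update_apply]
      split_ifs
      · rfl
      · rfl
      · omega
    · rw [update_of_ne (by omega), update_of_ne (by omega), hf]
      constructor
      · rintro ⟨i, hi, h3, h4⟩
        exact ⟨i, mem_insert_of_mem hi, h3, by rw [hcol i hi, h4]⟩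
      · rintro ⟨i, hi, h3, h4⟩
        rcases mem_insert.1 hi with hik | hi
        · rw [hik] at h3 h4
          rw [update_self] at h4
          exact absurd ⟨h3, h4⟩ hk'
        · rw [hcol i hi] at h4
          exact ⟨i, hi, h3, h4⟩
  · have g1 := mt (h.flag _ hu x hx hx0).2 h1
    have g2 := mt (h.flag _ hv x hx hx0).2 h2
    rcases hs with hs | hs | hs | hs
    · exact g1 ⟨i, hi, Or.inl hs, hc⟩
    · exact g2 ⟨i, hi, Or.inl hs, hc⟩
    · exact g1 ⟨i, hi, Or.inr hs, hc⟩
    · exact g2 ⟨i, hi, Or.inr hs, hc⟩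
  · rw [numColored_insert hk, if_neg hx0, h.val_eq]

/-- If the coloring extends to a proper coloring `C`, then the color `C k` is free at both ends
of the edge numbered `k`. -/
lemma Partial.free {Q : Finset ℕ} {C : ℕ → ℕ} {k : ℕ} (h : Partial n eu ev P fr col val)
    (hk : k ∉ P) (hu : eu k < n) (hv : ev k < n) (hC : Proper eu ev Q C) (hPQ : P ⊆ Q)
    (hkQ : k ∈ Q) (hag : ∀ i ∈ P, col i = C i) (h0 : C k ≠ 0) :
    fr (4 * eu k + C k) ≠ 0 ∧ fr (4 * ev k + C k) ≠ 0 := by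
  have key : ∀ w < n, (eu k = w ∨ ev k = w) → fr (4 * w + C k) ≠ 0 := by
    intro w hw hkw hc
    obtain ⟨i, hi, h1, h2⟩ := (h.flag w hw _ (hC.le k hkQ) h0).1 hc
    rw [hag i hi] at h2
    refine h0 (h2 ▸ hC.ne i (hPQ hi) k hkQ (by rintro rfl; exact hk hi) ?_ h2)
    unfold Share
    omega
  exact ⟨key _ hu (Or.inl rfl), key _ hv (Or.inr rfl)⟩

end

/-- The set of free colors at the vertex `w`, as a number. -/
def mask (fr : ℕ → ℕ) (w : ℕ) : ℕ := fr (4 * w + 1) + fr (4 * w + 2) + fr (4 * w + 2)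

/-- The set of colors `b` contains the color `x`, or `x = 0`. -/
def Allowed (b x : ℕ) : Prop := x = 0 ∨ x = 1 ∧ (b = 1 ∨ b = 3) ∨ x = 2 ∧ (b = 2 ∨ b = 3)

/-- The value of coloring an edge between `p` and `v` with the color `x`, when the colors in `b` are
free at `p`, the colors in `f` are free at `v`, and `M` contains the values of the subtrees. -/
def cand (M : ℕ → ℕ) (p v b f x : ℕ) : ℕ :=
  M (4 * p + (b - x)) + M (4 * v + (f - x)) + if x = 0 then 0 else 1

/-- The table `M` arises from the table `M'` by one step of the dynamic program, which adds an edge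
between `p` and `v`; `dec b` is the best color if the colors in `b` are free at `p`. -/
structure Merge (n p v f : ℕ) (M M' dec : ℕ → ℕ) : Prop where
  keep : ∀ w < n, w ≠ p → ∀ b < 4, M (4 * w + b) = M' (4 * w + b)
  dec_allowed : ∀ b < 4, Allowed b (dec b) ∧ Allowed f (dec b)
  eq : ∀ b < 4, M (4 * p + b) = cand M' p v b f (dec b)
  le : ∀ b < 4, ∀ x, Allowed b x → Allowed f x → cand M' p v b f x ≤ M (4 * p + b)

/-- The edges numbered `0, …, t - 1` form a tree, edge number `i` joins the parent `eu i` to its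
child `ev i`, and edges closer to the root come first. -/
structure TreeOrder (n t : ℕ) (eu ev : ℕ → ℕ) : Prop where
  eu_lt : ∀ i < t, eu i < n
  ev_lt : ∀ i < t, ev i < n
  ev_ne : ∀ i j, i < j → j < t → ev i ≠ ev j
  eu_ne : ∀ i j, i ≤ j → j < t → eu i ≠ ev j

/-- The vertices that are not the lower end of a tree edge numbered `i` or more. -/
def roots (n t : ℕ) (ev : ℕ → ℕ) (i : ℕ) : Finset ℕ :=
  {w ∈ range n | ∀ j ∈ Ico i t, ev j ≠ w}

/-- The value of the tables at the current roots. -/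
def potential (n t : ℕ) (ev : ℕ → ℕ) (i : ℕ) (M fr : ℕ → ℕ) : ℕ :=
  ∑ w ∈ roots n t ev i, M (4 * w + mask fr w)

section
variable {n t : ℕ} {eu ev : ℕ → ℕ}

lemma TreeOrder.roots_succ (h : TreeOrder n t eu ev) {i : ℕ} (hi : i < t) :
    roots n t ev (i + 1) = insert (ev i) (roots n t ev i) ∧ ev i ∉ roots n t ev i ∧
      eu i ∈ roots n t ev i := by
  refine ⟨?_, ?_, ?_⟩
  · ext w
    simp only [roots, mem_filter, mem_range, mem_insert, mem_Ico]
    constructor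
    · rintro ⟨hw, h1⟩
      by_cases hwi : w = ev i
      · exact Or.inl hwi
      · refine Or.inr ⟨hw, fun j hj => ?_⟩
        rcases Nat.lt_or_ge i j with hij | hij
        · exact h1 j ⟨hij, hj.2⟩
        · obtain rfl : j = i := by omega
          exact fun hc => hwi hc.symm
    · rintro (rfl | ⟨hw, h1⟩)
      · exact ⟨h.ev_lt i hi, fun j hj => (h.ev_ne i j (by omega) hj.2).symm⟩
      · exact ⟨hw, fun j hj => h1 j ⟨by omega, hj.2⟩⟩
  · simp only [roots, mem_filter, mem_Ico, not_and, not_forall]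
    exact fun _ => ⟨i, ⟨le_rfl, hi⟩, fun hc => hc rfl⟩
  · simp only [roots, mem_filter, mem_range, mem_Ico]
    exact ⟨h.eu_lt i hi, fun j hj => (h.eu_ne i j hj.1 hj.2).symm⟩

lemma TreeOrder.potential_step (h : TreeOrder n t eu ev) {i : ℕ} (hi : i < t) {f : ℕ}
    {M M' dec fr fr' : ℕ → ℕ} (hM : Merge n (eu i) (ev i) f M M' dec)
    (hb : ∀ w < n, mask fr w < 4)
    (hfr : ∀ w, w ≠ eu i → w ≠ ev i → mask fr' w = mask fr w) :
    ∃ rest, potential n t ev i M fr = M (4 * eu i + mask fr (eu i)) + rest ∧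
      potential n t ev (i + 1) M' fr' =
        M' (4 * eu i + mask fr' (eu i)) + M' (4 * ev i + mask fr' (ev i)) + rest := by
  obtain ⟨h1, h2, h3⟩ := h.roots_succ hi
  refine ⟨∑ w ∈ (roots n t ev i).erase (eu i), M (4 * w + mask fr w), ?_, ?_⟩
  · unfold potential
    rw [add_sum_erase _ (fun w => M (4 * w + mask fr w)) h3]
  · unfold potential
    rw [h1, sum_insert h2, ← add_sum_erase _ (fun w => M' (4 * w + mask fr' w)) h3]
    have : ∑ w ∈ (roots n t ev i).erase (eu i), M' (4 * w + mask fr' w) =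
        ∑ w ∈ (roots n t ev i).erase (eu i), M (4 * w + mask fr w) := by
      refine sum_congr rfl fun w hw => ?_
      have hwp := ne_of_mem_erase hw
      have hwr := mem_of_mem_erase hw
      have hwv : w ≠ ev i := by
        rintro rfl
        exact h2 hwr
      have hwn : w < n := mem_range.1 (mem_of_mem_filter _ hwr)
      rw [hfr w hwp hwv, hM.keep w hwn hwp _ (hb w hwn)]
    rw [this]
    ring

variable {P : Finset ℕ} {fr fr₀ col : ℕ → ℕ} {val : ℕ}

lemma Partial.mask_lt (h : Partial n eu ev P fr col val) {w : ℕ} (hw : w < n) :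
    mask fr w < 4 := by
  have h1 := h.flag_le w hw 1 (by omega)
  have h2 := h.flag_le w hw 2 (by omega)
  unfold mask
  omega

lemma Partial.allowed_mask_iff (h : Partial n eu ev P fr col val) {w x : ℕ} (hw : w < n) :
    Allowed (mask fr w) x ↔ x = 0 ∨ x ≤ 2 ∧ fr (4 * w + x) ≠ 0 := by
  have h1 := h.flag_le w hw 1 (by omega)
  have h2 := h.flag_le w hw 2 (by omega)
  unfold mask Allowed
  constructor
  · rintro (rfl | ⟨rfl, h3⟩ | ⟨rfl, h3⟩) <;> omega
  · rintro (rfl | ⟨h3, h4⟩)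
    · exact Or.inl rfl
    · interval_cases x <;> omega

lemma Partial.mask_update (h : Partial n eu ev P fr col val) {p v x : ℕ} (hp : p < n) (hv : v < n)
    (hx : x ≤ 2) (hpv : p ≠ v) (h1 : fr (4 * p + x) ≠ 0) (h2 : fr (4 * v + x) ≠ 0) :
    (∀ w, w ≠ p → w ≠ v →
      mask (update (update fr (4 * p + x) 0) (4 * v + x) 0) w = mask fr w) ∧
    mask (update (update fr (4 * p + x) 0) (4 * v + x) 0) p = mask fr p - x ∧
    mask (update (update fr (4 * p + x) 0) (4 * v + x) 0) v = mask fr v - x := by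
  have a1 := h.flag_le p hp 1 (by omega)
  have a2 := h.flag_le p hp 2 (by omega)
  have a3 := h.flag_le v hv 1 (by omega)
  have a4 := h.flag_le v hv 2 (by omega)
  have a5 := h.zero p hp
  have h3 : x = 1 ∨ x = 2 := by
    rcases x with _ | _ | _ | x
    · exact absurd a5 h1
    · exact Or.inl rfl
    · exact Or.inr rfl
    · omega
  unfold mask
  simp only [update_apply]
  refine ⟨fun w hw1 hw2 => ?_, ?_, ?_⟩
  · rw [if_neg (by omega), if_neg (by omega), if_neg (by omega), if_neg (by omega)]
  · rcases h3 with rfl | rfl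
    · rw [if_neg (by omega), if_pos (by omega), if_neg (by omega), if_neg (by omega)]
      omega
    · rw [if_neg (by omega), if_neg (by omega), if_neg (by omega), if_pos (by omega)]
      omega
  · rcases h3 with rfl | rfl
    · rw [if_pos (by omega), if_neg (by omega), if_neg (by omega)]
      omega
    · rw [if_neg (by omega), if_neg (by omega), if_pos (by omega)]
      omega

/-- The tables `Ms i` of the dynamic program for the tree edges, given the free colors `fr₀` before
any tree edge is colored. -/
def Tables (n t : ℕ) (eu ev fr₀ : ℕ → ℕ) (Ms : ℕ → ℕ → ℕ) (dec : ℕ → ℕ) (i : ℕ) : Prop :=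
  ∀ j, i ≤ j → j < t →
    Merge n (eu j) (ev j) (mask fr₀ (ev j)) (Ms j) (Ms (j + 1)) (fun b => dec (4 * j + b))

/-- The state of coloring the tree edges, when the edges numbered less than `i` are done. -/
structure Descent (n t : ℕ) (eu ev : ℕ → ℕ) (P₀ : Finset ℕ) (fr₀ : ℕ → ℕ) (i : ℕ)
    (fr col : ℕ → ℕ) (val : ℕ) : Prop where
  part : Partial n eu ev (P₀ ∪ range i) fr col val
  same : ∀ j, i ≤ j → j < t → ∀ x ≤ 2, fr (4 * ev j + x) = fr₀ (4 * ev j + x)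

variable {P₀ : Finset ℕ} {i : ℕ} {Ms : ℕ → ℕ → ℕ} {dec : ℕ → ℕ}

lemma Descent.mask_eq (h : Descent n t eu ev P₀ fr₀ i fr col val) (hi : i < t) :
    mask fr (ev i) = mask fr₀ (ev i) := by
  unfold mask
  rw [h.same i le_rfl hi 1 (by omega), h.same i le_rfl hi 2 (by omega)]

lemma union_range_succ (P : Finset ℕ) (i : ℕ) :
    P ∪ range (i + 1) = insert i (P ∪ range i) := by
  rw [range_add_one, union_insert]

lemma Descent.skip (h : Descent n t eu ev P₀ fr₀ i fr col val) (hi : i ∉ P₀) :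
    Descent n t eu ev P₀ fr₀ (i + 1) fr (update col i 0) val where
  part := by
    rw [union_range_succ]
    exact h.part.skip (by simp [hi])
  same j hj := h.same j (by omega)

lemma Descent.color (h : Descent n t eu ev P₀ fr₀ i fr col val) (ht : TreeOrder n t eu ev)
    (hi : i ∉ P₀) (hit : i < t) {x : ℕ} (hx : x ≤ 2) (h1 : fr (4 * eu i + x) ≠ 0)
    (h2 : fr (4 * ev i + x) ≠ 0) :
    Descent n t eu ev P₀ fr₀ (i + 1) (update (update fr (4 * eu i + x) 0) (4 * ev i + x) 0)
      (update col i x) (val + 1) where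
  part := by
    rw [union_range_succ]
    exact h.part.color (by simp [hi]) (ht.eu_lt i hit) (ht.ev_lt i hit) hx h1 h2
  same j hj hjt y hy := by
    have e1 := ht.eu_ne i j (by omega) hjt
    have e2 := ht.ev_ne i j (by omega) hjt
    rw [update_of_ne (by omega), update_of_ne (by omega), h.same j (by omega) hjt y hy]

lemma Descent.potential_color (h : Descent n t eu ev P₀ fr₀ i fr col val)
    (ht : TreeOrder n t eu ev) (hit : i < t) (hM : Tables n t eu ev fr₀ Ms dec i) {x : ℕ}
    (hx : x ≤ 2) (h1 : fr (4 * eu i + x) ≠ 0) (h2 : fr (4 * ev i + x) ≠ 0) :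
    potential n t ev (i + 1) (Ms (i + 1))
        (update (update fr (4 * eu i + x) 0) (4 * ev i + x) 0) + 1 ≤
      potential n t ev i (Ms i) fr ∧
    (x = dec (4 * i + mask fr (eu i)) →
      potential n t ev (i + 1) (Ms (i + 1))
        (update (update fr (4 * eu i + x) 0) (4 * ev i + x) 0) + 1 =
      potential n t ev i (Ms i) fr) := by
  have hm := hM i le_rfl hit
  have hp := ht.eu_lt i hit
  have hv := ht.ev_lt i hit
  obtain ⟨k1, k2, k3⟩ := h.part.mask_update hp hv hx (ht.eu_ne i i le_rfl hit) h1 h2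
  obtain ⟨rest, r1, r2⟩ := ht.potential_step hit hm (fun w hw => h.part.mask_lt hw) k1
  have hx0 : x ≠ 0 := by
    rintro rfl
    exact h1 (h.part.zero _ hp)
  have hb := h.part.mask_lt hp
  have a1 : Allowed (mask fr (eu i)) x := (h.part.allowed_mask_iff hp).2 (Or.inr ⟨hx, h1⟩)
  have a2 : Allowed (mask fr₀ (ev i)) x := by
    rw [← h.mask_eq hit]
    exact (h.part.allowed_mask_iff hv).2 (Or.inr ⟨hx, h2⟩)
  have e : cand (Ms (i + 1)) (eu i) (ev i) (mask fr (eu i)) (mask fr₀ (ev i)) x + rest =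
      potential n t ev (i + 1) (Ms (i + 1))
        (update (update fr (4 * eu i + x) 0) (4 * ev i + x) 0) + 1 := by
    rw [r2, k2, k3, h.mask_eq hit, cand, if_neg hx0]
    ring
  refine ⟨?_, fun hd => ?_⟩
  · rw [← e, r1]
    exact Nat.add_le_add_right (hm.le _ hb x a1 a2) _
  · rw [← e, r1, hm.eq _ hb, ← hd]

lemma Descent.potential_skip (h : Descent n t eu ev P₀ fr₀ i fr col val)
    (ht : TreeOrder n t eu ev) (hit : i < t) (hM : Tables n t eu ev fr₀ Ms dec i) :
    potential n t ev (i + 1) (Ms (i + 1)) fr ≤ potential n t ev i (Ms i) fr ∧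
    (dec (4 * i + mask fr (eu i)) = 0 →
      potential n t ev (i + 1) (Ms (i + 1)) fr = potential n t ev i (Ms i) fr) := by
  have hm := hM i le_rfl hit
  have hp := ht.eu_lt i hit
  obtain ⟨rest, r1, r2⟩ := ht.potential_step hit hm (fr' := fr)
    (fun w hw => h.part.mask_lt hw) (fun _ _ _ => rfl)
  have hb := h.part.mask_lt hp
  have e : cand (Ms (i + 1)) (eu i) (ev i) (mask fr (eu i)) (mask fr₀ (ev i)) 0 + rest =
      potential n t ev (i + 1) (Ms (i + 1)) fr := by
    rw [r2, h.mask_eq hit, cand, if_pos rfl, Nat.sub_zero, Nat.sub_zero, add_zero]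
  refine ⟨?_, fun hd => ?_⟩
  · rw [← e, r1]
    exact Nat.add_le_add_right (hm.le _ hb 0 (Or.inl rfl) (Or.inl rfl)) _
  · rw [← e, r1, hm.eq _ hb, hd]

/-- No proper coloring that extends the given coloring of the other edges beats the dynamic
program. -/
theorem numColored_le_potential (ht : TreeOrder n t eu ev)
    (hM : Tables n t eu ev fr₀ Ms dec 0) (h : Partial n eu ev P₀ fr₀ col val)
    (hP₀ : ∀ i < t, i ∉ P₀) {C : ℕ → ℕ} (hC : Proper eu ev (P₀ ∪ range t) C)
    (hag : ∀ i ∈ P₀, col i = C i) :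
    numColored (P₀ ∪ range t) C ≤ val + potential n t ev 0 (Ms 0) fr₀ := by
  have key : ∀ i ≤ t, ∃ fr col' val', Descent n t eu ev P₀ fr₀ i fr col' val' ∧
      (∀ j ∈ P₀ ∪ range i, col' j = C j) ∧
      val' + potential n t ev i (Ms i) fr ≤ val + potential n t ev 0 (Ms 0) fr₀ := by
    intro i
    induction i with
    | zero =>
      intro _
      exact ⟨fr₀, col, val, ⟨by simpa using h, fun _ _ _ _ _ => rfl⟩, by simpa using hag, le_rfl⟩
    | succ i ih =>
      intro hi
      obtain ⟨fr, col', val', hd, hag', hle⟩ := ih (by omega)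
      have hag'' : ∀ j ∈ P₀ ∪ range (i + 1), update col' i (C i) j = C j := by
        intro j hj
        rw [union_range_succ] at hj
        by_cases hji : j = i
        · rw [hji, update_self]
        · rw [update_of_ne hji]
          exact hag' j ((mem_insert.1 hj).resolve_left hji)
      have hMi : Tables n t eu ev fr₀ Ms dec i := fun j _ => hM j (Nat.zero_le _)
      have hiP := hP₀ i (by omega)
      have hmem : i ∈ P₀ ∪ range t := mem_union_right _ (mem_range.2 (by omega))
      by_cases h0 : C i = 0
      · refine ⟨fr, update col' i 0, val', hd.skip hiP, h0 ▸ hag'', ?_⟩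
        have := (hd.potential_skip ht (by omega) hMi).1
        omega
      · obtain ⟨g1, g2⟩ := hd.part.free (k := i) (by simp [hiP]) (ht.eu_lt i (by omega))
          (ht.ev_lt i (by omega)) hC
          (union_subset_union le_rfl (range_subset_range.2 (by omega)))
          hmem hag' h0
        refine ⟨_, _, _, hd.color ht hiP (by omega) (hC.le i hmem) g1 g2, hag'', ?_⟩
        have := (hd.potential_color ht (by omega) hMi (hC.le i hmem) g1 g2).1
        omega
  obtain ⟨fr, col', val', hd, hag', hle⟩ := key t le_rfl
  have hv := hd.part.val_eq
  have : numColored (P₀ ∪ range t) col' = numColored (P₀ ∪ range t) C := by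
    unfold numColored
    rw [filter_congr fun j hj => by rw [hag' j hj]]
  omega

/-- One step of coloring the tree edges with the colors chosen by the dynamic program. -/
lemma Descent.step (h : Descent n t eu ev P₀ fr₀ i fr col val) (ht : TreeOrder n t eu ev)
    (hP₀ : i ∉ P₀) (hit : i < t) (hM : Tables n t eu ev fr₀ Ms dec i) {x : ℕ}
    (hx : x = dec (4 * i + mask fr (eu i))) :
    (fr (4 * eu i + x) = 0 ∨ fr (4 * ev i + x) = 0 →
      Descent n t eu ev P₀ fr₀ (i + 1) fr (update col i 0) val ∧
      potential n t ev (i + 1) (Ms (i + 1)) fr = potential n t ev i (Ms i) fr) ∧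
    (fr (4 * eu i + x) ≠ 0 → fr (4 * ev i + x) ≠ 0 →
      Descent n t eu ev P₀ fr₀ (i + 1) (update (update fr (4 * eu i + x) 0) (4 * ev i + x) 0)
        (update col i x) (val + 1) ∧
      potential n t ev (i + 1) (Ms (i + 1))
        (update (update fr (4 * eu i + x) 0) (4 * ev i + x) 0) + 1 =
      potential n t ev i (Ms i) fr) := by
  have hp := ht.eu_lt i hit
  have hv := ht.ev_lt i hit
  have hm := (hM i le_rfl hit).dec_allowed _ (h.part.mask_lt hp)
  simp only [← hx] at hm
  rw [← h.mask_eq hit, h.part.allowed_mask_iff hp, h.part.allowed_mask_iff hv] at hm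
  refine ⟨fun h0 => ⟨h.skip hP₀, (h.potential_skip ht hit hM).2 ?_⟩, fun h1 h2 => ?_⟩
  · rw [← hx]
    by_contra hc
    rcases h0 with h0 | h0
    · exact (hm.1.resolve_left hc).2 h0
    · exact (hm.2.resolve_left hc).2 h0
  · have hx2 : x ≤ 2 := by omega
    exact ⟨h.color ht hP₀ hit hx2 h1 h2, (h.potential_color ht hit hM hx2 h1 h2).2 hx⟩

end

end MaxTwoEdgeCol

namespace RAM

open Function

infixr:60 " ;; " => Cmd.seq

/-- The registers, arrays and matrix entries that make up a configuration of the random access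
machine, see `Cfg.toState`. -/
structure Cfg where
  r : ℕ → ℕ
  A : ℕ → ℕ → ℕ
  M : ℕ → ℕ

/-- The registers `0` and `1` contain `n` and `n * n`, the matrix is stored in the first `n * n`
cells, and sixteen arrays share the cells behind it. -/
def Cfg.toState (n : ℕ) (σ : Cfg) : State where
  reg x := if x = 0 then n else if x = 1 then n * n else σ.r x
  mem a := if a < n * n then σ.M a else σ.A ((a - n * n) % 16) ((a - n * n) / 16)

/-- Write a register. -/
def Cfg.set (σ : Cfg) (x v : ℕ) : Cfg := { σ with r := update σ.r x v }

/-- Write an entry of an array. -/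
def Cfg.put (σ : Cfg) (j i v : ℕ) : Cfg := { σ with A := update σ.A j (update (σ.A j) i v) }

/-- Write an entry of the matrix. -/
def Cfg.putM (σ : Cfg) (i v : ℕ) : Cfg := { σ with M := update σ.M i v }

section
variable (σ : Cfg) (x y v i j k : ℕ)

@[simp] lemma Cfg.set_r : (σ.set x v).r y = if y = x then v else σ.r y := by
  simp [Cfg.set, update_apply]
@[simp] lemma Cfg.set_A : (σ.set x v).A = σ.A := rfl
@[simp] lemma Cfg.set_M : (σ.set x v).M = σ.M := rfl
@[simp] lemma Cfg.put_r : (σ.put j i v).r = σ.r := rfl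
@[simp] lemma Cfg.put_A :
    (σ.put j i v).A k = if k = j then update (σ.A j) i v else σ.A k := by
  simp only [Cfg.put, update_apply]
@[simp] lemma Cfg.put_M : (σ.put j i v).M = σ.M := rfl
@[simp] lemma Cfg.putM_r : (σ.putM i v).r = σ.r := rfl
@[simp] lemma Cfg.putM_A : (σ.putM i v).A = σ.A := rfl
@[simp] lemma Cfg.putM_M : (σ.putM i v).M = update σ.M i v := rfl

end

/-- Twice the value of an expression. -/
def Expr.dbl (e : Expr) : Expr := .add e e

/-- The address of the entry `e` of the array `j`. -/
def Expr.addr (j : ℕ) (e : Expr) : Expr :=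
  .add (.add (.var 1) (.const j)) e.dbl.dbl.dbl.dbl

/-- The entry `e` of the array `j`. -/
def Expr.get (j : ℕ) (e : Expr) : Expr := .load (e.addr j)

/-- Assign to a register. -/
abbrev Cmd.set (x : ℕ) (e : Expr) : Cmd := .assign x e

/-- Assign to an entry of an array. -/
def Cmd.put (j : ℕ) (i e : Expr) : Cmd := .store (i.addr j) e

/-- Assign to an entry of the matrix. -/
def Cmd.putM (i e : Expr) : Cmd := .store i e

/-- Execute `c` with the register `x` running through the numbers less than the value of the
register `y`. -/
def Cmd.for_ (x y : ℕ) (c : Cmd) : Cmd :=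
  .set x (.const 0) ;; .loop (.sub (.var y) (.var x)) (c ;; .set x (.add (.var x) (.const 1)))

/-- The value of an expression. -/
def Cfg.ev (n : ℕ) (σ : Cfg) (e : Expr) : ℕ := e.eval (σ.toState n)

section
variable (n : ℕ) (σ : Cfg) (a b e : Expr) (x j c : ℕ)

@[simp] lemma Cfg.ev_const : σ.ev n (.const c) = c := rfl
@[simp] lemma Cfg.ev_add : σ.ev n (.add a b) = σ.ev n a + σ.ev n b := rfl
@[simp] lemma Cfg.ev_sub : σ.ev n (.sub a b) = σ.ev n a - σ.ev n b := rfl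
@[simp] lemma Cfg.ev_zero : σ.ev n (.var 0) = n := rfl
@[simp] lemma Cfg.ev_one : σ.ev n (.var 1) = n * n := rfl
@[simp] lemma Cfg.ev_var (h : 2 ≤ x) : σ.ev n (.var x) = σ.r x := by
  simp only [Cfg.ev, Expr.eval, Cfg.toState]
  rw [if_neg (by omega), if_neg (by omega)]
@[simp] lemma Cfg.ev_dbl : σ.ev n e.dbl = 2 * σ.ev n e := by
  rw [Expr.dbl, Cfg.ev_add, two_mul]

lemma Cfg.ev_addr : σ.ev n (e.addr j) = n * n + j + 16 * σ.ev n e := by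
  simp [Expr.addr]
  ring

@[simp] lemma Cfg.ev_get (h : j < 16) : σ.ev n (e.get j) = σ.A j (σ.ev n e) := by
  have h1 : σ.ev n (e.get j) = (σ.toState n).mem (σ.ev n (e.addr j)) := rfl
  rw [h1, Cfg.ev_addr]
  simp only [Cfg.toState]
  rw [if_neg (by omega), show (n * n + j + 16 * σ.ev n e - n * n) % 16 = j by omega,
    show (n * n + j + 16 * σ.ev n e - n * n) / 16 = σ.ev n e by omega]

lemma Cfg.ev_load (h : σ.ev n e < n * n) : σ.ev n (.load e) = σ.M (σ.ev n e) := by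
  have h1 : σ.ev n (.load e) = (σ.toState n).mem (σ.ev n e) := rfl
  rw [h1]
  simp only [Cfg.toState]
  rw [if_pos h]

end

/-- From the configuration `σ`, the command `c` halts after at most `T` steps in a configuration
with the property `Q`. -/
def Runs (n : ℕ) (c : Cmd) (σ : Cfg) (T : ℕ) (Q : Cfg → Prop) : Prop :=
  ∃ σ' t, Exec c (σ.toState n) (Cfg.toState n σ') t ∧ t ≤ T ∧ Q σ'

section
variable {n : ℕ} {σ : Cfg} {T T₁ T₂ : ℕ} {Q R : Cfg → Prop} {c d : Cmd} {b e i : Expr} {x j : ℕ}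

lemma Runs.mono (h : Runs n c σ T Q) (hT : T ≤ T₁) (hQ : ∀ τ, Q τ → R τ) : Runs n c σ T₁ R := by
  obtain ⟨σ', t, h1, h2, h3⟩ := h
  exact ⟨σ', t, h1, h2.trans hT, hQ _ h3⟩

lemma Runs.skip (h : Q σ) : Runs n .skip σ 1 Q := ⟨σ, 1, .skip _, le_rfl, h⟩

lemma Runs.seq (h : Runs n c σ T₁ fun τ => Runs n d τ T₂ Q) : Runs n (c ;; d) σ (T₁ + T₂) Q := by
  obtain ⟨σ', t, h1, h2, σ'', t', h3, h4, h5⟩ := h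
  exact ⟨σ'', t + t', .seq h1 h3, by omega, h5⟩

lemma Runs.set (hx : 2 ≤ x) (h : Q (σ.set x (σ.ev n e))) :
    Runs n (.set x e) σ (e.cost + 1) Q := by
  refine ⟨σ.set x (σ.ev n e), _, ?_, le_rfl, h⟩
  convert Exec.assign (σ.toState n) x e using 1
  simp only [Cfg.toState, State.mk.injEq]
  refine ⟨?_, rfl⟩
  funext y
  simp only [Cfg.set_r, update_apply, Cfg.ev, Cfg.toState]
  split_ifs <;> first | rfl | omega

lemma Runs.put (hj : j < 16) (h : Q (σ.put j (σ.ev n i) (σ.ev n e))) :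
    Runs n (.put j i e) σ ((i.addr j).cost + e.cost + 1) Q := by
  refine ⟨σ.put j (σ.ev n i) (σ.ev n e), _, ?_, le_rfl, h⟩
  unfold Cmd.put
  convert Exec.store (σ.toState n) (i.addr j) e using 1
  have ha : (i.addr j).eval (σ.toState n) = n * n + j + 16 * σ.ev n i := Cfg.ev_addr n σ i j
  rw [ha]
  simp only [Cfg.toState, State.mk.injEq]
  refine ⟨rfl, ?_⟩
  funext a
  simp only [Cfg.put_A, Cfg.put_M, update_apply]
  by_cases h1 : a < n * n
  · rw [if_pos h1, if_neg (by omega), if_pos h1]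
  · rw [if_neg h1, if_neg h1]
    by_cases h2 : (a - n * n) % 16 = j
    · rw [if_pos h2, update_apply]
      by_cases h3 : (a - n * n) / 16 = σ.ev n i
      · rw [if_pos h3, if_pos (by omega)]
        rfl
      · rw [if_neg h3, if_neg (by omega), h2]
    · rw [if_neg h2, if_neg (by omega)]

lemma Runs.putM (hi : σ.ev n i < n * n) (h : Q (σ.putM (σ.ev n i) (σ.ev n e))) :
    Runs n (.putM i e) σ (i.cost + e.cost + 1) Q := by
  refine ⟨σ.putM (σ.ev n i) (σ.ev n e), _, ?_, le_rfl, h⟩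
  unfold Cmd.putM
  convert Exec.store (σ.toState n) i e using 1
  have ha : i.eval (σ.toState n) = σ.ev n i := rfl
  rw [ha]
  simp only [Cfg.toState, State.mk.injEq]
  refine ⟨rfl, ?_⟩
  funext a
  simp only [Cfg.putM_A, Cfg.putM_M, update_apply]
  by_cases h1 : a < n * n
  · rw [if_pos h1, if_pos h1]
    rfl
  · rw [if_neg h1, if_neg h1, if_neg (by omega)]

lemma Runs.ite (h1 : σ.ev n b ≠ 0 → Runs n c σ T₁ Q) (h2 : σ.ev n b = 0 → Runs n d σ T₂ Q) :
    Runs n (.ite b c d) σ (b.cost + 1 + (T₁ + T₂)) Q := by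
  by_cases h : σ.ev n b = 0
  · obtain ⟨σ', t, h3, h4, h5⟩ := h2 h
    exact ⟨σ', _, .ite_false h h3, by omega, h5⟩
  · obtain ⟨σ', t, h3, h4, h5⟩ := h1 h
    exact ⟨σ', _, .ite_true h h3, by omega, h5⟩

/-- The rule for `for` loops: `Inv k` holds when `k` iterations are done. -/
lemma Runs.for_ {m y : ℕ} (Inv : ℕ → Cfg → Prop) (hx : 2 ≤ x)
    (h0 : Inv 0 (σ.set x 0))
    (hm : ∀ k τ, Inv k τ → τ.ev n (.var y) = m)
    (hstep : ∀ k τ, k < m → τ.r x = k → Inv k τ →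
      Runs n c τ T fun τ' => τ'.r x = k ∧ Inv (k + 1) (τ'.set x (k + 1)))
    (hQ : ∀ τ, τ.r x = m → Inv m τ → Q τ) :
    Runs n (.for_ x y c) σ (m * (T + 9) + 7) Q := by
  have key : ∀ l k τ, k + l = m → τ.r x = k → Inv k τ →
      Runs n (.loop (.sub (.var y) (.var x)) (c ;; .set x (.add (.var x) (.const 1)))) τ
        (l * (T + 9) + 4) Q := by
    intro l
    induction l with
    | zero =>
      intro k τ hk hr hi
      obtain rfl : k = m := by omega
      refine ⟨τ, _, Exec.loop_stop ?_, ?_, hQ τ hr hi⟩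
      · change τ.ev n (.sub (.var y) (.var x)) = 0
        rw [Cfg.ev_sub, Cfg.ev_var _ _ _ hx, hm _ _ hi, hr, Nat.sub_self]
      · simp only [Expr.cost]
        omega
    | succ l ih =>
      intro k τ hk hr hi
      have h1 : Runs n (c ;; .set x (.add (.var x) (.const 1))) τ (T + 4) fun τ' =>
          τ'.r x = k + 1 ∧ Inv (k + 1) τ' := by
        refine Runs.seq ((hstep k τ (by omega) hr hi).mono le_rfl fun τ' h => ?_)
        refine Runs.set hx ?_
        rw [Cfg.ev_add, Cfg.ev_var _ _ _ hx, h.1, Cfg.ev_const]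
        exact ⟨by simp, h.2⟩
      obtain ⟨τ', t', h2, h3, h4, h5⟩ := h1
      obtain ⟨τ'', t'', h6, h7, h8⟩ := ih (k + 1) τ' (by omega) h4 h5
      refine ⟨τ'', _, .loop_step ?_ h2 h6, ?_, h8⟩
      · change τ.ev n (.sub (.var y) (.var x)) ≠ 0
        rw [Cfg.ev_sub, Cfg.ev_var _ _ _ hx, hm _ _ hi, hr]
        omega
      · simp only [Expr.cost, Nat.succ_mul]
        omega
  refine (Runs.seq (Runs.set hx ?_) : Runs n (.for_ x y c) σ
    (((Expr.const 0).cost + 1) + (m * (T + 9) + 4)) Q).mono ?_ fun _ h => h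
  · exact key m 0 _ (by omega) (by simp) h0
  · simp only [Expr.cost]
    omega

end

end RAM

namespace MaxTwoEdgeCol

open RAM Function

/-- Execute `c` with the registers `2` and `3` running through all pairs of vertices. -/
def scan (c : Cmd) : Cmd := .for_ 2 0 (.for_ 3 0 c)

/-- The number of steps of `scan`. -/
def scanTime (n T : ℕ) : ℕ := n * (n * (T + 9) + 7 + 9) + 7

lemma runs_scan {n T : ℕ} {σ : Cfg} {c : Cmd} {Q : Cfg → Prop} (Inv : ℕ → ℕ → Cfg → Prop)
    (hreg : ∀ u v x k τ, x = 2 ∨ x = 3 → Inv u v τ → Inv u v (τ.set x k))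
    (h0 : Inv 0 0 σ)
    (hstep : ∀ u v τ, u < n → v < n → τ.r 2 = u → τ.r 3 = v → Inv u v τ →
      Runs n c τ T fun τ' => τ'.r 2 = u ∧ τ'.r 3 = v ∧ Inv u (v + 1) τ')
    (hrow : ∀ u τ, u < n → Inv u n τ → Inv (u + 1) 0 τ)
    (hQ : ∀ τ, Inv n 0 τ → Q τ) : Runs n (scan c) σ (scanTime n T) Q := by
  refine Runs.for_ (fun u τ => Inv u 0 τ) (by norm_num) (hreg _ _ _ _ _ (Or.inl rfl) h0)
    (fun _ τ _ => Cfg.ev_zero n τ) ?_ (fun τ _ h => hQ τ h)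
  intro u τ hu hτ hi
  refine Runs.for_ (fun v τ => τ.r 2 = u ∧ Inv u v τ) (by norm_num)
    ⟨by simpa using hτ, hreg _ _ _ _ _ (Or.inr rfl) hi⟩ (fun _ τ _ => Cfg.ev_zero n τ) ?_ ?_
  · intro v τ hv h3 ⟨h2, hi⟩
    refine (hstep u v τ hu hv h2 h3 hi).mono le_rfl fun τ' h => ?_
    exact ⟨h.2.1, by simpa using h.1, hreg _ _ _ _ _ (Or.inr rfl) h.2.2⟩
  · intro τ _ h
    exact ⟨h.1, hreg _ _ _ _ _ (Or.inl rfl) (hrow u τ hu h.2)⟩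

/-- The number of the matrix entry for the pair of vertices in the registers `x` and `y`; the
array `0` contains the numbers of the first entries of the rows. -/
def cell (x y : ℕ) : Expr := .add (.get 0 (.var x)) (.var y)

/-- Append the edge between the vertices in the registers `2` and `3` to the list of edges, and
delete it from the matrix. The length of the list is in the register `5`, the ends of the edges are
in the arrays `2` and `3`. -/
def addEdge : Cmd :=
  .put 2 (.var 5) (.var 2) ;; .put 3 (.var 5) (.var 3) ;; .set 5 (.add (.var 5) (.const 1)) ;;
    .putM (cell 2 3) (.const 0) ;; .putM (cell 3 2) (.const 0)

/-- Store the numbers of the first entries of the rows of the matrix. -/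
def rowStarts : Cmd :=
  .set 23 (.const 0) ;; .for_ 2 0 (.put 0 (.var 2) (.var 23) ;; .set 23 (.add (.var 23) (.var 0)))

/-- Move the edge between the vertices in the registers `2` and `3` to the list if it joins a vertex
of the tree to another vertex. The array `1` marks the vertices of the tree. -/
def addTreeEdge : Cmd :=
  .ite (.get 1 (.var 2)) (.ite (.get 1 (.var 3)) .skip
    (.ite (.load (cell 2 3)) (addEdge ;; .put 1 (.var 3) (.const 1)) .skip)) .skip

/-- List the edges of a spanning tree, and store their number in the register `6`. -/
def listTree : Cmd :=
  .put 1 (.const 0) (.const 1) ;; .set 5 (.const 0) ;; .for_ 4 0 (scan addTreeEdge) ;;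
    .set 6 (.var 5)

/-- List the other edges, and store their number in the register `7`. -/
def listOthers : Cmd :=
  scan (.ite (.load (cell 2 3)) addEdge .skip) ;; .set 7 (.sub (.var 5) (.var 6))

/-- Store the powers of `3` in the array `4`, and the number of colorings of the edges outside the
tree in the register `18`. -/
def powers : Cmd :=
  .put 4 (.const 0) (.const 1) ;;
  .for_ 10 7 (.put 4 (.add (.var 10) (.const 1))
    (.add (.get 4 (.var 10)) (.add (.get 4 (.var 10)) (.get 4 (.var 10))))) ;;
  .set 18 (.get 4 (.var 7)) ;; .set 17 (.const 0)

lemma cell_lt {n u v : ℕ} (hu : u < n) (hv : v < n) : u * n + v < n * n := by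
  have : (u + 1) * n ≤ n * n := Nat.mul_le_mul_right _ hu
  rw [Nat.succ_mul] at this
  omega

lemma cell_inj {n u v u' v' : ℕ} (hv : v < n) (hv' : v' < n) :
    u * n + v = u' * n + v' ↔ u = u' ∧ v = v' := by
  refine ⟨fun h => ?_, fun h => by rw [h.1, h.2]⟩
  have h1 : u = u' := by
    have := congrArg (· / n) h
    rwa [mul_comm, Nat.mul_add_div (by omega), Nat.div_eq_of_lt hv, mul_comm,
      Nat.mul_add_div (by omega), Nat.div_eq_of_lt hv'] at this
  subst h1
  exact ⟨rfl, by omega⟩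

/-- The unordered pairs `{u, v}` and `{u', v'}` are equal. -/
def SamePair (u v u' v' : ℕ) : Prop := u = u' ∧ v = v' ∨ u = v' ∧ v = u'

/-- The matrix `mat` contains the edges that are not among the `m` listed ones. -/
structure Listed (n : ℕ) (adj : ℕ → ℕ → Prop) (m : ℕ) (eu ev mat : ℕ → ℕ) : Prop where
  lt : ∀ i < m, eu i < n ∧ ev i < n ∧ adj (eu i) (ev i)
  inj : ∀ i j, i < j → j < m → ¬ SamePair (eu i) (ev i) (eu j) (ev j)
  mat_iff : ∀ u < n, ∀ v < n,
    mat (u * n + v) ≠ 0 ↔ adj u v ∧ ∀ i < m, ¬ SamePair (eu i) (ev i) u v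

lemma Listed.add {n : ℕ} {adj : ℕ → ℕ → Prop} {m : ℕ} {eu ev mat : ℕ → ℕ}
    (h : Listed n adj m eu ev mat) {u v : ℕ} (hu : u < n) (hv : v < n)
    (huv : mat (u * n + v) ≠ 0) :
    Listed n adj (m + 1) (update eu m u) (update ev m v)
      (update (update mat (u * n + v) 0) (v * n + u) 0) := by
  have h1 := (h.mat_iff u hu v hv).1 huv
  have ne : ∀ i < m, i ≠ m := fun i hi => hi.ne
  constructor
  · intro i hi
    rcases Nat.lt_succ_iff_lt_or_eq.1 hi with hi | rfl
    · simpa [ne i hi] using h.lt i hi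
    · simpa using ⟨hu, hv, h1.1⟩
  · intro i j hij hj
    rw [update_of_ne (by omega), update_of_ne (by omega)]
    rcases Nat.lt_succ_iff_lt_or_eq.1 hj with hj | rfl
    · simpa [ne j hj] using h.inj i j hij hj
    · simpa using h1.2 i hij
  · intro u' hu' v' hv'
    have h2 : (∀ i < m + 1, ¬ SamePair (update eu m u i) (update ev m v i) u' v') ↔
        (∀ i < m, ¬ SamePair (eu i) (ev i) u' v') ∧ ¬ SamePair u v u' v' := by
      constructor
      · intro hc
        refine ⟨fun i hi => ?_, by simpa using hc m (by omega)⟩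
        simpa [ne i hi] using hc i (by omega)
      · rintro ⟨h3, h4⟩ i hi
        rcases Nat.lt_succ_iff_lt_or_eq.1 hi with hi | rfl
        · simpa [ne i hi] using h3 i hi
        · simpa using h4
    rw [h2, ← and_assoc, ← h.mat_iff u' hu' v' hv']
    simp only [update_apply, cell_inj hv' hv, cell_inj hv' hu]
    unfold SamePair
    split_ifs <;> simp_all
    all_goals omega

end MaxTwoEdgeCol

namespace MaxTwoEdgeCol

open RAM Function

/-- The configuration contains the row starts and a list of edges. -/
def ListedCfg (n : ℕ) (adj : ℕ → ℕ → Prop) (σ : Cfg) : Prop :=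
  (∀ u < n, σ.A 0 u = u * n) ∧ Listed n adj (σ.r 5) (σ.A 2) (σ.A 3) σ.M

section
variable {n : ℕ} {adj : ℕ → ℕ → Prop} {σ : Cfg} {Q : Cfg → Prop}

lemma ev_cell {x y : ℕ} (hx : 2 ≤ x) (hy : 2 ≤ y) (h : ∀ u < n, σ.A 0 u = u * n)
    (hu : σ.r x < n) : σ.ev n (cell x y) = σ.r x * n + σ.r y := by
  simp [cell, hx, hy, h _ hu]

lemma runs_addEdge (h : ListedCfg n adj σ) (hu : σ.r 2 < n) (hv : σ.r 3 < n)
    (huv : σ.M (σ.r 2 * n + σ.r 3) ≠ 0)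
    (hQ : ∀ τ, ListedCfg n adj τ → τ.r = update σ.r 5 (σ.r 5 + 1) →
      (∀ j, j ≠ 2 → j ≠ 3 → τ.A j = σ.A j) → τ.A 2 = update (σ.A 2) (σ.r 5) (σ.r 2) →
      τ.A 3 = update (σ.A 3) (σ.r 5) (σ.r 3) →
      τ.M = update (update σ.M (σ.r 2 * n + σ.r 3) 0) (σ.r 3 * n + σ.r 2) 0 → Q τ) :
    Runs n addEdge σ 200 Q := by
  have h2 := h.2.add hu hv huv
  refine Runs.mono (Runs.seq (Runs.put (by norm_num) (Runs.seq (Runs.put (by norm_num)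
    (Runs.seq (Runs.set (by norm_num) (Runs.seq (Runs.putM ?_ (Runs.putM ?_ ?_))))))))) (by decide)
    fun _ h => h
  · rw [ev_cell (by norm_num) (by norm_num) (by simpa using h.1) (by simpa using hu)]
    simpa using cell_lt hu hv
  · rw [ev_cell (by norm_num) (by norm_num) (by simpa using h.1) (by simpa using hv)]
    simpa using cell_lt hv hu
  · rw [ev_cell (by norm_num) (by norm_num) (by simpa using h.1) (by simpa using hu),
      ev_cell (by norm_num) (by norm_num) (by simpa using h.1) (by simpa using hv)]
    refine hQ _ ⟨?_, ?_⟩ ?_ ?_ ?_ ?_ ?_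
    · simpa using h.1
    · simpa using h2
    · funext y
      simp [update_apply]
    · intro j h2 h3
      simp [h2, h3]
    · simp
    · simp
    · simp

lemma runs_rowStarts (hQ : ∀ τ, (∀ u < n, τ.A 0 u = u * n) → (∀ j ≠ 0, τ.A j = σ.A j) →
    τ.M = σ.M → Q τ) : Runs n rowStarts σ (2 + (n * (50 + 9) + 7)) Q := by
  refine Runs.seq (Runs.set (by norm_num) (Runs.for_ (fun k τ => τ.r 23 = k * n ∧
    (∀ u < k, τ.A 0 u = u * n) ∧ (∀ j ≠ 0, τ.A j = σ.A j) ∧ τ.M = σ.M) (by norm_num) ?_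
    (fun _ τ _ => Cfg.ev_zero n τ) ?_ fun τ _ h => hQ τ h.2.1 h.2.2.1 h.2.2.2))
  · simp
  · rintro k τ hk h2 ⟨h3, h4, h5, h6⟩
    refine Runs.mono (Runs.seq (Runs.put (by norm_num) (Runs.set (by norm_num) ?_)))
      (by decide) fun _ h => h
    simp only [Cfg.ev_add, Cfg.ev_zero, Cfg.ev_var, Cfg.put_r, Cfg.set_r, Cfg.put_A, Cfg.set_A,
      Cfg.put_M, Cfg.set_M, h2, h3, Nat.reduceLeDiff, Nat.reduceEqDiff, if_true, if_false]
    refine ⟨trivial, by ring, fun u hu => ?_, fun j hj => by simp [hj, h5], h6⟩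
    rcases Nat.lt_succ_iff_lt_or_eq.1 hu with hu | rfl
    · rw [update_of_ne (by omega), h4 u hu]
    · rw [update_self]

/-- The vertices reached from vertex `0` in at most `r` steps. -/
def ReachIn (adj : ℕ → ℕ → Prop) : ℕ → ℕ → Prop
  | 0, w => w = 0
  | r + 1, w => ReachIn adj r w ∨ ∃ u, ReachIn adj r u ∧ adj u w

/-- The listed edges form a tree, the vertices of which are marked by `inT`. -/
structure Tree (n m : ℕ) (eu ev inT : ℕ → ℕ) : Prop where
  order : TreeOrder n m eu ev
  inT_iff : ∀ w < n, inT w ≠ 0 ↔ w = 0 ∨ ∃ i < m, ev i = w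
  eu_mem : ∀ i < m, inT (eu i) ≠ 0
  ev_pos : ∀ i < m, ev i ≠ 0

lemma Tree.add {m : ℕ} {eu ev inT : ℕ → ℕ} (h : Tree n m eu ev inT) {u v : ℕ} (hu : u < n)
    (hv : v < n) (hu' : inT u ≠ 0) (hv' : inT v = 0) :
    Tree n (m + 1) (update eu m u) (update ev m v) (update inT v 1) := by
  have hnv : ∀ w, inT w ≠ 0 → w ≠ v := by
    rintro w h rfl
    exact h hv'
  have hev : ∀ i < m, ev i ≠ v := by
    rintro i hi rfl
    exact ((h.inT_iff _ hv).2 (Or.inr ⟨i, hi, rfl⟩)) hv'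
  have ne : ∀ i < m, i ≠ m := fun i hi => hi.ne
  refine ⟨⟨fun i hi => ?_, fun i hi => ?_, fun i j hij hj => ?_, fun i j hij hj => ?_⟩,
    fun w hw => ?_, fun i hi => ?_, fun i hi => ?_⟩
  · rcases Nat.lt_succ_iff_lt_or_eq.1 hi with hi | rfl
    · simpa [ne i hi] using h.order.eu_lt i hi
    · simpa
  · rcases Nat.lt_succ_iff_lt_or_eq.1 hi with hi | rfl
    · simpa [ne i hi] using h.order.ev_lt i hi
    · simpa
  · rw [update_of_ne (by omega)]
    rcases Nat.lt_succ_iff_lt_or_eq.1 hj with hj | rfl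
    · simpa [ne j hj] using h.order.ev_ne i j hij hj
    · simpa using hev i hij
  · rcases Nat.lt_succ_iff_lt_or_eq.1 hj with hj | rfl
    · rw [update_of_ne (by omega), update_of_ne (by omega)]
      exact h.order.eu_ne i j hij hj
    · rw [update_self]
      rcases Nat.lt_or_eq_of_le hij with hij | rfl
      · rw [update_of_ne (by omega)]
        exact hnv _ (h.eu_mem i hij)
      · rw [update_self]
        exact hnv _ hu'
  · by_cases hwv : w = v
    · subst hwv
      rw [update_self]
      exact iff_of_true one_ne_zero (Or.inr ⟨m, by omega, by simp⟩)
    · rw [update_of_ne hwv, h.inT_iff w hw]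
      refine or_congr_right ⟨fun ⟨i, hi, hw⟩ => ⟨i, by omega, by simpa [ne i hi]⟩, ?_⟩
      rintro ⟨i, hi, hw⟩
      rcases Nat.lt_succ_iff_lt_or_eq.1 hi with hi | rfl
      · exact ⟨i, hi, by simpa [ne i hi] using hw⟩
      · rw [update_self] at hw
        exact absurd hw.symm hwv
  · have h1 : inT (update eu m u i) ≠ 0 := by
      rcases Nat.lt_succ_iff_lt_or_eq.1 hi with hi | rfl
      · simpa [ne i hi] using h.eu_mem i hi
      · simpa
    rwa [update_of_ne (hnv _ h1)]
  · rcases Nat.lt_succ_iff_lt_or_eq.1 hi with hi | rfl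
    · simpa [ne i hi] using h.ev_pos i hi
    · rw [update_self]
      rintro rfl
      exact ((h.inT_iff 0 hv).2 (Or.inl rfl)) hv'

/-- The configuration contains a list of edges that form a tree. -/
def TreeCfg (n : ℕ) (adj : ℕ → ℕ → Prop) (σ : Cfg) : Prop :=
  ListedCfg n adj σ ∧ Tree n (σ.r 5) (σ.A 2) (σ.A 3) (σ.A 1)

lemma runs_addTreeEdge (h : TreeCfg n adj σ) (hu : σ.r 2 < n) (hv : σ.r 3 < n)
    (hQ : ∀ τ, TreeCfg n adj τ → τ.r 2 = σ.r 2 → τ.r 3 = σ.r 3 → τ.r 4 = σ.r 4 →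
      (∀ j, 4 ≤ j → τ.A j = σ.A j) → (∀ w, σ.A 1 w ≠ 0 → τ.A 1 w ≠ 0) →
      (σ.A 1 (σ.r 2) ≠ 0 → adj (σ.r 2) (σ.r 3) → τ.A 1 (σ.r 3) ≠ 0) → Q τ) :
    Runs n addTreeEdge σ 500 Q := by
  refine Runs.mono (Runs.ite (T₁ := 400) (T₂ := 1) (fun h1 => Runs.mono (Runs.ite (T₁ := 1)
    (fun h2 => Runs.skip ?_) fun h2 => Runs.ite (T₁ := 300) (T₂ := 1) (fun h3 => ?_)
    fun h3 => Runs.skip ?_) (by decide) fun _ h => h) fun h1 => Runs.skip ?_) (by decide)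
    fun _ h => h
  · simp only [Cfg.ev_get, Cfg.ev_var, Nat.reduceLeDiff, Nat.reduceLT] at h1 h2
    exact hQ σ h rfl rfl rfl (fun _ _ => rfl) (fun _ h => h) fun _ _ => h2
  · simp only [Cfg.ev_get, Cfg.ev_var, Nat.reduceLeDiff, Nat.reduceLT] at h1 h2
    have hc := ev_cell (σ := σ) (x := 2) (y := 3) (by norm_num) (by norm_num) h.1.1 hu
    rw [Cfg.ev_load _ _ _ (by rw [hc]; exact cell_lt hu hv), hc] at h3
    refine Runs.mono (Runs.seq (runs_addEdge h.1 hu hv h3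
      fun τ t1 t2 t3 t4 t5 t6 => Runs.put (by norm_num) ?_)) (by decide) fun _ h => h
    have ht := h.2.add hu hv h1 h2
    have hr3 : τ.r 3 = σ.r 3 := by simp [t2]
    refine hQ _ ⟨?_, ?_⟩ ?_ ?_ ?_ ?_ ?_ ?_
    · exact ⟨by simpa using t1.1, by simpa using t1.2⟩
    · simpa [t2, t3, t4, t5] using ht
    · simp [t2]
    · simp [t2]
    · simp [t2]
    · intro j hj
      rw [Cfg.put_A, if_neg (by omega), t3 j (by omega) (by omega)]
    · intro w hw
      simp only [Cfg.put_A, if_true, Cfg.ev_const, t3 1 (by norm_num) (by norm_num), update_apply]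
      split_ifs
      · exact one_ne_zero
      · exact hw
    · simp [hr3]
  · simp only [Cfg.ev_get, Cfg.ev_var, Nat.reduceLeDiff, Nat.reduceLT] at h1 h2
    have hc := ev_cell (σ := σ) (x := 2) (y := 3) (by norm_num) (by norm_num) h.1.1 hu
    rw [Cfg.ev_load _ _ _ (by rw [hc]; exact cell_lt hu hv), hc] at h3
    refine hQ σ h rfl rfl rfl (fun _ _ => rfl) (fun _ h => h) fun _ hadj => ?_
    have h4 := mt (h.1.2.mat_iff _ hu _ hv).2 (not_not.2 h3)
    simp only [hadj, true_and, not_forall, not_not] at h4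
    obtain ⟨i, hi, h4⟩ := h4
    rcases h4 with h4 | h4
    · rw [← h4.2]
      exact (h.2.inT_iff _ (h.2.order.ev_lt i hi)).2 (Or.inr ⟨i, hi, rfl⟩)
    · rw [← h4.1]
      exact h.2.eu_mem i hi
  · simp only [Cfg.ev_get, Cfg.ev_var, Nat.reduceLeDiff, Nat.reduceLT] at h1
    exact hQ σ h rfl rfl rfl (fun _ _ => rfl) (fun _ h => h) fun hc => absurd h1 hc

lemma runs_listTree (h : ∀ u < n, σ.A 0 u = u * n)
    (hlt : ∀ u v, adj u v → u < n ∧ v < n)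
    (hM : ∀ u < n, ∀ v < n, σ.M (u * n + v) ≠ 0 ↔ adj u v)
    (h1 : ∀ i, σ.A 1 i = 0)
    (hQ : ∀ τ, TreeCfg n adj τ → τ.r 6 = τ.r 5 → (∀ j, 4 ≤ j → τ.A j = σ.A j) →
      (∀ w, ReachIn adj n w → τ.A 1 w ≠ 0) → Q τ) :
    Runs n listTree σ (60 + (n * (scanTime n 500 + 9) + 7)) Q := by
  have hscan : ∀ k τ, τ.r 4 = k → TreeCfg n adj τ → (∀ j, 4 ≤ j → τ.A j = σ.A j) →
      (∀ w, ReachIn adj k w → τ.A 1 w ≠ 0) →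
      Runs n (scan addTreeEdge) τ (scanTime n 500) fun τ' => τ'.r 4 = k ∧
        TreeCfg n adj τ' ∧ (∀ j, 4 ≤ j → τ'.A j = σ.A j) ∧
        ∀ w, ReachIn adj (k + 1) w → τ'.A 1 w ≠ 0 := by
    intro k τ t1 t2 t3 t4
    refine runs_scan (fun u v τ => τ.r 4 = k ∧ TreeCfg n adj τ ∧
      (∀ j, 4 ≤ j → τ.A j = σ.A j) ∧ (∀ w, ReachIn adj k w → τ.A 1 w ≠ 0) ∧
      ∀ u' v', u' < u ∨ u' = u ∧ v' < v → ReachIn adj k u' → adj u' v' → τ.A 1 v' ≠ 0)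
      ?_ ⟨t1, t2, t3, t4, by omega⟩ ?_ ?_ ?_
    · rintro u v x l τ (rfl | rfl) h <;> simpa [TreeCfg, ListedCfg] using h
    · rintro u v τ hu hv h2 h3 ⟨i1, i2, i3, i4, i5⟩
      refine runs_addTreeEdge i2 (h2 ▸ hu) (h3 ▸ hv) fun τ' a1 a2 a3 a4 a5 a6 a7 => ?_
      refine ⟨a2.trans h2, a3.trans h3, a4.trans i1, a1, fun j hj => (a5 j hj).trans (i3 j hj),
        fun w hw => a6 w (i4 w hw), fun u' v' huv hr hadj => ?_⟩
      by_cases hc : u' < u ∨ u' = u ∧ v' < v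
      · exact a6 _ (i5 u' v' hc hr hadj)
      · obtain ⟨rfl, rfl⟩ : u' = u ∧ v' = v := by omega
        rw [h2, h3] at a7
        exact a7 (i4 _ hr) hadj
    · rintro u τ hu ⟨i1, i2, i3, i4, i5⟩
      refine ⟨i1, i2, i3, i4, fun u' v' huv hr hadj => i5 u' v' ?_ hr hadj⟩
      have := (hlt _ _ hadj).2
      omega
    · rintro τ ⟨i1, i2, i3, i4, i5⟩
      refine ⟨i1, i2, i3, ?_⟩
      rintro w (hw | ⟨u, hu, hadj⟩)
      · exact i4 w hw
      · exact i5 u w (Or.inl (hlt _ _ hadj).1) hu hadj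
  refine Runs.mono (Runs.seq (Runs.put (by norm_num) (Runs.seq (Runs.set (by norm_num) (Runs.seq
    (Runs.for_ (fun k τ => TreeCfg n adj τ ∧ (∀ j, 4 ≤ j → τ.A j = σ.A j) ∧
      ∀ w, ReachIn adj k w → τ.A 1 w ≠ 0) (by norm_num) ?_ (fun _ τ _ => Cfg.ev_zero n τ)
      (fun k τ hk hr hi => (hscan k τ hr hi.1 hi.2.1 hi.2.2).mono le_rfl fun τ' h => ⟨h.1, ?_⟩)
      fun τ hr hi => Runs.set (by norm_num) ?_)))))) ?_ fun _ h => h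
  · refine ⟨⟨⟨by simpa using h, ?_⟩, ?_⟩, ?_, ?_⟩
    · constructor
      · simp
      · simp
      · simpa using hM
    · refine ⟨⟨?_, ?_, ?_, ?_⟩, ?_, ?_, ?_⟩ <;> simp [update_apply, h1]
    · intro j hj
      simp only [Cfg.set_A, Cfg.put_A]
      rw [if_neg (by omega)]
    · rintro w rfl
      simp
  · refine ⟨⟨?_, ?_⟩, ?_, ?_⟩
    · exact ⟨by simpa using h.2.1.1.1, by simpa using h.2.1.1.2⟩
    · simpa using h.2.1.2
    · simpa using h.2.2.1
    · simpa using h.2.2.2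
  · refine hQ _ ⟨⟨?_, ?_⟩, ?_⟩ ?_ ?_ ?_
    · simpa using hi.1.1.1
    · simpa using hi.1.1.2
    · simpa using hi.1.2
    · simp
    · simpa using hi.2.1
    · simpa using hi.2.2
  · simp [Expr.cost, Expr.addr, Expr.dbl]
    omega

end

end MaxTwoEdgeCol

namespace MaxTwoEdgeCol

open RAM Function Finset

/-- A list of all edges, beginning with the `t` edges of a spanning tree. -/
structure EdgeList (n : ℕ) (adj : ℕ → ℕ → Prop) (m t : ℕ) (eu ev : ℕ → ℕ) : Prop where
  lt : ∀ i < m, eu i < n ∧ ev i < n ∧ adj (eu i) (ev i)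
  inj : ∀ i j, i < j → j < m → ¬ SamePair (eu i) (ev i) (eu j) (ev j)
  complete : ∀ u v, adj u v → ∃ i < m, SamePair (eu i) (ev i) u v
  order : TreeOrder n t eu ev
  le : t ≤ m
  card : t + 1 = n

/-- The part of the configuration that does not change during the search. -/
structure Static (n m t : ℕ) (eu ev : ℕ → ℕ) (σ : Cfg) : Prop where
  rows : ∀ u < n, σ.A 0 u = u * n
  eu_eq : σ.A 2 = eu
  ev_eq : σ.A 3 = ev
  m_eq : σ.r 5 = m
  t_eq : σ.r 6 = t
  c_eq : σ.r 7 = m - t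
  pow_eq : ∀ k ≤ m - t, σ.A 4 k = 3 ^ k
  total_eq : σ.r 18 = 3 ^ (m - t)

section
variable {n m t : ℕ} {adj : ℕ → ℕ → Prop} {eu ev : ℕ → ℕ} {σ τ : Cfg} {Q : Cfg → Prop}

lemma Static.congr (h : Static n m t eu ev σ) (h5 : τ.r 5 = σ.r 5) (h6 : τ.r 6 = σ.r 6)
    (h7 : τ.r 7 = σ.r 7) (h18 : τ.r 18 = σ.r 18) (hA : ∀ j ≤ 4, τ.A j = σ.A j) :
    Static n m t eu ev τ where
  rows := by rw [hA 0 (by norm_num)]; exact h.rows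
  eu_eq := by rw [hA 2 (by norm_num), h.eu_eq]
  ev_eq := by rw [hA 3 (by norm_num), h.ev_eq]
  m_eq := h5.trans h.m_eq
  t_eq := h6.trans h.t_eq
  c_eq := h7.trans h.c_eq
  pow_eq := by rw [hA 4 (by norm_num)]; exact h.pow_eq
  total_eq := h18.trans h.total_eq

lemma TreeOrder.congr {eu' ev' : ℕ → ℕ} (h : TreeOrder n t eu ev) (h1 : ∀ i < t, eu' i = eu i)
    (h2 : ∀ i < t, ev' i = ev i) : TreeOrder n t eu' ev' where
  eu_lt i hi := by rw [h1 i hi]; exact h.eu_lt i hi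
  ev_lt i hi := by rw [h2 i hi]; exact h.ev_lt i hi
  ev_ne i j hij hj := by rw [h2 i (hij.trans hj), h2 j hj]; exact h.ev_ne i j hij hj
  eu_ne i j hij hj := by rw [h1 i (hij.trans_lt hj), h2 j hj]; exact h.eu_ne i j hij hj

lemma Tree.card_eq {inT : ℕ → ℕ} (h : Tree n t eu ev inT) (hn : 0 < n)
    (hall : ∀ w < n, inT w ≠ 0) : t + 1 = n := by
  have h1 : insert 0 ((range t).image ev) = range n := by
    ext w
    simp only [mem_insert, mem_image, mem_range]
    constructor
    · rintro (rfl | ⟨i, hi, rfl⟩)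
      · exact hn
      · exact h.order.ev_lt i hi
    · intro hw
      exact (h.inT_iff w hw).1 (hall w hw)
  have h2 : #((range t).image ev) = t := by
    rw [card_image_of_injOn, card_range]
    intro i hi j hj hij
    rw [coe_range, Set.mem_Iio] at hi hj
    rcases Nat.lt_trichotomy i j with hlt | he | hlt
    · exact absurd hij (h.order.ev_ne i j hlt hj)
    · exact he
    · exact absurd hij.symm (h.order.ev_ne j i hlt hi)
  have h3 : 0 ∉ (range t).image ev := by
    simp only [mem_image, mem_range, not_exists, not_and]
    exact h.ev_pos
  rw [← card_range n, ← h1, card_insert_of_notMem h3, h2]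

lemma runs_listOthers (h : ListedCfg n adj σ) (ht : TreeOrder n t (σ.A 2) (σ.A 3))
    (h6 : σ.r 6 = t) (h5 : t ≤ σ.r 5) (hlt : ∀ u v, adj u v → u < n ∧ v < n)
    (hcard : t + 1 = n)
    (hQ : ∀ τ, (∀ u < n, τ.A 0 u = u * n) →
      EdgeList n adj (τ.r 5) t (τ.A 2) (τ.A 3) → τ.r 6 = t → τ.r 7 = τ.r 5 - t →
      (∀ u < n, ∀ v < n, τ.M (u * n + v) = 0) → Q τ) :
    Runs n listOthers σ (scanTime n 400 + 4) Q := by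
  refine Runs.seq (runs_scan (fun u v τ => ListedCfg n adj τ ∧ TreeOrder n t (τ.A 2) (τ.A 3) ∧
      τ.r 6 = t ∧ t ≤ τ.r 5 ∧ ∀ u' v', u' < n → v' < n → u' < u ∨ u' = u ∧ v' < v →
        τ.M (u' * n + v') = 0) ?_ ⟨h, ht, h6, h5, by omega⟩ ?_ ?_ ?_)
  · rintro u v x l τ (rfl | rfl) h <;> simpa [ListedCfg] using h
  · rintro u v τ hu hv h2 h3 ⟨i1, i2, i3, i4, i5⟩
    subst h2 h3
    have hc := ev_cell (σ := τ) (x := 2) (y := 3) (by norm_num) (by norm_num) i1.1 hu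
    have hl := Cfg.ev_load n τ _ (by rw [hc]; exact cell_lt hu hv)
    refine Runs.mono (Runs.ite (T₁ := 200) (T₂ := 1) (fun h1 => ?_) fun h1 => Runs.skip ?_)
      (by decide) fun _ h => h
    · rw [hl, hc] at h1
      refine runs_addEdge i1 hu hv h1 fun τ' t1 t2 t3 t4 t5 t6 => ?_
      refine ⟨by simp [t2], by simp [t2], t1, i2.congr ?_ ?_, by simp [t2, i3], ?_, ?_⟩
      · intro i hi
        rw [t4, update_of_ne (by omega)]
      · intro i hi
        rw [t5, update_of_ne (by omega)]
      · rw [t2, update_self]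
        omega
      · intro u' v' hu' hv' huv
        have h4 : u' < τ.r 2 ∨ u' = τ.r 2 ∧ v' < τ.r 3 ∨ u' = τ.r 2 ∧ v' = τ.r 3 := by omega
        rw [t6]
        simp only [update_apply, cell_inj hv' hv, cell_inj hv' hu]
        rcases h4 with h4 | h4 | h4
        · rw [i5 u' v' hu' hv' (Or.inl h4)]
          simp
        · rw [i5 u' v' hu' hv' (Or.inr h4)]
          simp
        · simp [h4]
    · rw [hl, hc] at h1
      refine ⟨rfl, rfl, i1, i2, i3, i4, fun u' v' hu' hv' huv => ?_⟩
      by_cases hc' : u' < τ.r 2 ∨ u' = τ.r 2 ∧ v' < τ.r 3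
      · exact i5 u' v' hu' hv' hc'
      · obtain ⟨rfl, rfl⟩ : u' = τ.r 2 ∧ v' = τ.r 3 := by omega
        exact h1
  · rintro u τ hu ⟨i1, i2, i3, i4, i5⟩
    exact ⟨i1, i2, i3, i4, fun u' v' hu' hv' huv => i5 u' v' hu' hv' (by omega)⟩
  · rintro τ ⟨i1, i2, i3, i4, i5⟩
    have hz : ∀ u < n, ∀ v < n, τ.M (u * n + v) = 0 := fun u hu v hv =>
      i5 u v hu hv (Or.inl hu)
    refine Runs.set (by norm_num) (hQ _ ?_ ⟨?_, ?_, ?_, ?_, ?_, hcard⟩ ?_ ?_ ?_)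
    · simpa using i1.1
    · simpa using i1.2.lt
    · simpa using i1.2.inj
    · intro u v huv
      obtain ⟨hu, hv⟩ := hlt u v huv
      have := mt (i1.2.mat_iff u hu v hv).2 (not_not.2 (hz u hu v hv))
      simpa [huv] using this
    · simpa using i2
    · simpa using i4
    · simpa using i3
    · simp [i3]
    · simpa using hz

lemma runs_powers (h0 : ∀ u < n, σ.A 0 u = u * n) (h2 : σ.A 2 = eu) (h3 : σ.A 3 = ev)
    (h5 : σ.r 5 = m) (h6 : σ.r 6 = t) (h7 : σ.r 7 = m - t)
    (hQ : ∀ τ, Static n m t eu ev τ → τ.M = σ.M → τ.r 17 = 0 → Q τ) :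
    Runs n powers σ (300 + ((m - t) * (500 + 9) + 7)) Q := by
  refine Runs.mono (Runs.seq (Runs.put (by norm_num) (Runs.seq (Runs.for_ (T := 500) (m := m - t)
    (fun k τ => (∀ j, j ≠ 4 → τ.A j = σ.A j) ∧ (∀ l ≤ k, τ.A 4 l = 3 ^ l) ∧ τ.M = σ.M ∧
      τ.r 5 = m ∧ τ.r 6 = t ∧ τ.r 7 = m - t) (by norm_num) ?_ ?_ ?_ fun τ _ hi =>
    Runs.seq (Runs.set (by norm_num) (Runs.set (by norm_num) (hQ _ ⟨?_, ?_, ?_, ?_, ?_, ?_, ?_, ?_⟩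
      ?_ ?_)))))))  ?_ fun _ h => h
  · simp [h5, h6, h7]
    intro j hj
    simp [hj]
  · intro k τ hi
    simp [hi.2.2.2.2.2]
  · rintro k τ hk hr ⟨i1, i2, i3, i4, i5, i6⟩
    refine Runs.mono (Runs.put (by norm_num) ?_) (by decide) fun _ h => h
    simp only [Cfg.ev_add, Cfg.ev_get, Cfg.ev_var, Cfg.ev_const, hr, Nat.reduceLeDiff,
      Nat.reduceLT, i2 k le_rfl]
    refine ⟨by simpa using hr, fun j hj => by simp [hj, i1], fun l hl => ?_, by simpa using i3,
      by simpa using i4, by simpa using i5, by simpa using i6⟩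
    simp only [Cfg.set_A, Cfg.put_A, if_true]
    rcases Nat.lt_or_eq_of_le hl with hl | rfl
    · rw [update_of_ne (by omega), i2 l (by omega)]
    · rw [update_self, pow_succ]
      ring
  · simpa [hi.1] using h0
  · simpa [hi.1] using h2
  · simpa [hi.1] using h3
  · simpa using hi.2.2.2.1
  · simpa using hi.2.2.2.2.1
  · simpa using hi.2.2.2.2.2
  · simpa using hi.2.1
  · simp [hi.2.2.2.2.2, hi.2.1]
  · simpa using hi.2.2.1
  · simp
  · simp [Expr.cost, Expr.addr, Expr.dbl, Expr.get]
    omega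

end

/-- List the edges and compute the constants of the search. -/
def setup : Cmd := rowStarts ;; listTree ;; listOthers ;; powers

/-- The number of steps of `setup`. -/
def setupTime (n c : ℕ) : ℕ :=
  2 + (n * (50 + 9) + 7) + (60 + (n * (scanTime n 500 + 9) + 7) + (scanTime n 400 + 4 +
    (300 + (c * (500 + 9) + 7))))

lemma runs_setup {n c : ℕ} {adj : ℕ → ℕ → Prop} {σ : Cfg} {Q : Cfg → Prop} (hn : 0 < n)
    (hlt : ∀ u v, adj u v → u < n ∧ v < n)
    (hM : ∀ u < n, ∀ v < n, σ.M (u * n + v) ≠ 0 ↔ adj u v) (hA : ∀ j i, σ.A j i = 0)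
    (hreach : ∀ w < n, ReachIn adj n w)
    (hc : ∀ m t eu ev, EdgeList n adj m t eu ev → m - t ≤ c)
    (hQ : ∀ τ m t eu ev, EdgeList n adj m t eu ev → Static n m t eu ev τ →
      (∀ u < n, ∀ v < n, τ.M (u * n + v) = 0) → τ.r 17 = 0 → Q τ) :
    Runs n setup σ (setupTime n c) Q := by
  refine Runs.seq (runs_rowStarts fun τ a1 a2 a3 => Runs.seq (runs_listTree (adj := adj) a1 hlt
    (a3 ▸ hM) ?_ fun τ b1 b2 _ b4 => Runs.seq (runs_listOthers b1.1 b1.2.order b2 le_rfl hlt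
      (b1.2.card_eq hn fun w hw => b4 w (hreach w hw)) fun τ c1 c2 c3 c4 c5 =>
      Runs.mono (runs_powers c1 rfl rfl rfl c3 c4 fun τ d1 d2 d3 => hQ τ _ _ _ _ c2 d1 ?_ d3)
      ?_ fun _ h => h)))
  · rw [a2 1 (by norm_num)]
    exact hA 1
  · rw [d2]
    exact c5
  · have := hc _ _ _ _ c2
    gcongr

end MaxTwoEdgeCol

namespace MaxTwoEdgeCol

open RAM Function Finset

/-- Four times the value of `e`, plus `x`. -/
def quad (e x : Expr) : Expr := .add e.dbl.dbl x

@[simp] lemma ev_quad (n : ℕ) (σ : Cfg) (e x : Expr) :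
    σ.ev n (quad e x) = 4 * σ.ev n e + σ.ev n x := by
  simp [quad]
  ring

/-- The set of free colors at the vertex in the register `x`; the array `5` contains the flags. -/
def maskExpr (x : ℕ) : Expr :=
  .add (.add (.get 5 (quad (.var x) (.const 1))) (.get 5 (quad (.var x) (.const 2))))
    (.get 5 (quad (.var x) (.const 2)))

@[simp] lemma ev_maskExpr (n : ℕ) (σ : Cfg) {x : ℕ} (hx : 2 ≤ x) :
    σ.ev n (maskExpr x) = mask (σ.A 5) (σ.r x) := by
  simp [maskExpr, mask, hx]

/-- Make all colors free and clear the tables of the dynamic program, which are in the array `6`. -/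
def initTables : Cmd :=
  .for_ 3 0 (.put 5 (quad (.var 3) (.const 0)) (.const 0) ;;
    .put 5 (quad (.var 3) (.const 1)) (.const 1) ;; .put 5 (quad (.var 3) (.const 2)) (.const 1) ;;
    .put 6 (quad (.var 3) (.const 0)) (.const 0) ;; .put 6 (quad (.var 3) (.const 1)) (.const 0) ;;
    .put 6 (quad (.var 3) (.const 2)) (.const 0) ;; .put 6 (quad (.var 3) (.const 3)) (.const 0))

/-- Give the edge numbered by the register `15` the color in the register `12` if this color is free
at both ends, otherwise leave the edge uncolored. The colors are in the array `8`, the number of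
colored edges is in the register `16`. -/
def applyColor : Cmd :=
  .set 13 (.get 2 (.var 15)) ;; .set 14 (.get 3 (.var 15)) ;; .put 8 (.var 15) (.const 0) ;;
  .ite (.get 5 (quad (.var 13) (.var 12)))
    (.ite (.get 5 (quad (.var 14) (.var 12)))
      (.put 8 (.var 15) (.var 12) ;; .put 5 (quad (.var 13) (.var 12)) (.const 0) ;;
        .put 5 (quad (.var 14) (.var 12)) (.const 0) ;; .set 16 (.add (.var 16) (.const 1)))
      .skip) .skip

/-- Divide the register `9` by an entry of the array `4`, where the quotient is at most `2`. The
quotient is stored in the register `12`. -/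
def readDigit : Cmd :=
  .set 12 (.const 0) ;;
  .ite (.sub (.add (.var 9) (.const 1)) (.get 4 (.var 11)))
    (.set 9 (.sub (.var 9) (.get 4 (.var 11))) ;; .set 12 (.const 1) ;;
      .ite (.sub (.add (.var 9) (.const 1)) (.get 4 (.var 11)))
        (.set 9 (.sub (.var 9) (.get 4 (.var 11))) ;; .set 12 (.const 2)) .skip) .skip

/-- Color the edges outside the tree according to the ternary digits of the register `8`. -/
def colorOthers : Cmd :=
  .set 9 (.var 8) ;; .set 16 (.const 0) ;;
  .for_ 10 7 (
    .set 11 (.sub (.var 7) (.add (.var 10) (.const 1))) ;;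
    .set 15 (.add (.var 6) (.var 11)) ;; readDigit ;; applyColor)

section
variable {n m t : ℕ} {adj : ℕ → ℕ → Prop} {eu ev : ℕ → ℕ} {σ τ : Cfg} {Q : Cfg → Prop}

lemma runs_initTables
    (hQ : ∀ τ, (∀ j, j ≠ 3 → τ.r j = σ.r j) → (∀ j, j ≠ 5 → j ≠ 6 → τ.A j = σ.A j) →
      τ.M = σ.M → Partial n eu ev ∅ (τ.A 5) (τ.A 8) 0 →
      (∀ w < n, ∀ b < 4, τ.A 6 (4 * w + b) = 0) → Q τ) :
    Runs n initTables σ (n * (4000 + 9) + 7) Q := by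
  refine Runs.for_ (fun k τ => (∀ j, j ≠ 3 → τ.r j = σ.r j) ∧
    (∀ j, j ≠ 5 → j ≠ 6 → τ.A j = σ.A j) ∧ τ.M = σ.M ∧
    (∀ w < k, τ.A 5 (4 * w + 0) = 0 ∧ τ.A 5 (4 * w + 1) = 1 ∧ τ.A 5 (4 * w + 2) = 1) ∧
    ∀ w < k, ∀ b < 4, τ.A 6 (4 * w + b) = 0) (by norm_num) ?_
    (fun _ τ _ => Cfg.ev_zero n τ) ?_ ?_
  · simp +contextual
  · rintro k τ hk hr ⟨i1, i2, i3, i4, i5⟩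
    refine Runs.mono (Runs.seq (Runs.put (by norm_num) (Runs.seq (Runs.put (by norm_num)
      (Runs.seq (Runs.put (by norm_num) (Runs.seq (Runs.put (by norm_num)
      (Runs.seq (Runs.put (by norm_num) (Runs.seq (Runs.put (by norm_num)
      (Runs.put (by norm_num) ?_))))))))))))) (by decide) fun _ h => h
    simp only [ev_quad, Cfg.ev_var, Cfg.ev_const, Cfg.put_r, Cfg.put_A, Cfg.put_M, Cfg.set_r,
      Cfg.set_A, Cfg.set_M, hr, Nat.reduceLeDiff, Nat.reduceEqDiff, if_true, if_false]
    refine ⟨trivial, fun j hj => by simp [hj, i1 j hj], fun j h5 h6 => by simp [h5, h6, i2 j h5 h6],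
      i3, fun w hw => ?_, fun w hw b hb => ?_⟩
    · rcases Nat.lt_succ_iff_lt_or_eq.1 hw with hw | rfl
      · have := i4 w hw
        simp only [update_apply]
        refine ⟨?_, ?_, ?_⟩ <;> split_ifs <;> omega
      · simp
    · simp only [update_apply]
      split_ifs
      · rfl
      · rfl
      · rfl
      · rfl
      · exact i5 w (by omega) b hb
  · rintro τ hr ⟨i1, i2, i3, i4, i5⟩
    refine hQ τ i1 i2 i3 ⟨fun w hw x hx => ?_, fun w hw => (i4 w hw).1, fun w hw x hx hx0 => ?_,
      ⟨by simp, by simp⟩, by simp [numColored]⟩ i5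
    · have := i4 w hw
      interval_cases x <;> omega
    · have := i4 w hw
      interval_cases x
      · omega
      · simp [this]
      · simp [this]

lemma runs_applyColor (h2 : σ.A 2 = eu) (h3 : σ.A 3 = ev)
    (hQ : ∀ τ, (∀ j, j ≠ 13 → j ≠ 14 → j ≠ 16 → τ.r j = σ.r j) →
      (∀ j, j ≠ 5 → j ≠ 8 → τ.A j = σ.A j) → τ.M = σ.M →
      ((σ.A 5 (4 * eu (σ.r 15) + σ.r 12) = 0 ∨ σ.A 5 (4 * ev (σ.r 15) + σ.r 12) = 0) ∧
        τ.A 5 = σ.A 5 ∧ τ.A 8 = update (σ.A 8) (σ.r 15) 0 ∧ τ.r 16 = σ.r 16 ∨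
      σ.A 5 (4 * eu (σ.r 15) + σ.r 12) ≠ 0 ∧ σ.A 5 (4 * ev (σ.r 15) + σ.r 12) ≠ 0 ∧
        τ.A 5 = update (update (σ.A 5) (4 * eu (σ.r 15) + σ.r 12) 0)
          (4 * ev (σ.r 15) + σ.r 12) 0 ∧
        τ.A 8 = update (σ.A 8) (σ.r 15) (σ.r 12) ∧ τ.r 16 = σ.r 16 + 1) → Q τ) :
    Runs n applyColor σ 2000 Q := by
  refine Runs.mono (Runs.seq (Runs.set (by norm_num) (Runs.seq (Runs.set (by norm_num)
    (Runs.seq (Runs.put (by norm_num) (Runs.ite (fun c1 => Runs.ite (fun c2 =>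
      Runs.seq (Runs.put (by norm_num) (Runs.seq (Runs.put (by norm_num)
        (Runs.seq (Runs.put (by norm_num) (Runs.set (by norm_num) ?_)))))))
      fun c2 => Runs.skip ?_) fun c1 => Runs.skip ?_)))))))  (by decide) fun _ h => h
  · simp [h2, h3] at c1 c2
    refine hQ _ ?_ ?_ ?_ (Or.inr ⟨c1, c2, ?_, ?_, ?_⟩)
    · intro j j1 j2 j3
      simp [j1, j2, j3]
    · intro j j1 j2
      simp [j1, j2]
    · simp
    · simp [h2, h3]
    · simp
    · simp
  · simp [h2, h3] at c1 c2
    refine hQ _ ?_ ?_ ?_ (Or.inl ⟨Or.inr c2, ?_, ?_, ?_⟩)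
    · intro j j1 j2 j3
      simp [j1, j2]
    · intro j j1 j2
      simp [j2]
    · simp
    · simp
    · simp
    · simp
  · simp [h2, h3] at c1
    refine hQ _ ?_ ?_ ?_ (Or.inl ⟨Or.inl c1, ?_, ?_, ?_⟩)
    · intro j j1 j2 j3
      simp [j1, j2]
    · intro j j1 j2
      simp [j2]
    · simp
    · simp
    · simp
    · simp

/-- The number with ternary digits `C t, …, C (t + k - 1)`. -/
def code (t : ℕ) (C : ℕ → ℕ) (k : ℕ) : ℕ := ∑ l ∈ range k, C (t + l) * 3 ^ l

lemma code_lt {C : ℕ → ℕ} {k : ℕ} (h : ∀ l < k, C (t + l) ≤ 2) : code t C k < 3 ^ k := by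
  induction k with
  | zero => simp [code]
  | succ k ih =>
    have h1 := ih fun l hl => h l (by omega)
    have h2 := h k (by omega)
    unfold code at *
    rw [sum_range_succ, pow_succ]
    nlinarith [Nat.mul_le_mul_right (3 ^ k) h2]

lemma runs_readDigit
    (hQ : ∀ τ, (∀ j, j ≠ 9 → j ≠ 12 → τ.r j = σ.r j) → τ.A = σ.A → τ.M = σ.M → τ.r 12 ≤ 2 →
      (∀ d low, d ≤ 2 → low < σ.A 4 (σ.r 11) → σ.r 9 = low + d * σ.A 4 (σ.r 11) →
        τ.r 12 = d ∧ τ.r 9 = low) → Q τ) :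
    Runs n readDigit σ 500 Q := by
  refine Runs.mono (Runs.seq (Runs.set (by norm_num) (Runs.ite (fun c1 =>
    Runs.seq (Runs.set (by norm_num) (Runs.seq (Runs.set (by norm_num) (Runs.ite (fun c2 =>
      Runs.seq (Runs.set (by norm_num) (Runs.set (by norm_num) ?_)))
      fun c2 => Runs.skip ?_))))) fun c1 => Runs.skip ?_))) (by decide) fun _ h => h
  · simp at c1 c2
    refine hQ _ (fun j j1 j2 => by simp [j1, j2]) (by simp) (by simp) (by simp) ?_
    intro d low hd hlow he
    interval_cases d <;> simp <;> omega
  · simp [Nat.sub_eq_zero_iff_le] at c1 c2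
    refine hQ _ (fun j j1 j2 => by simp [j1, j2]) (by simp) (by simp) (by simp) ?_
    intro d low hd hlow he
    interval_cases d <;> simp <;> omega
  · simp [Nat.sub_eq_zero_iff_le] at c1
    refine hQ _ (fun j j1 j2 => by simp [j2]) (by simp) (by simp) (by simp) ?_
    intro d low hd hlow he
    interval_cases d <;> simp <;> omega

/-- The state of `colorOthers`, started in `σ`, when the `k` lowest digits remain. -/
structure OthersInv (n m t : ℕ) (eu ev : ℕ → ℕ) (σ : Cfg) (k : ℕ) (τ : Cfg) : Prop where
  static : Static n m t eu ev τ
  r8 : τ.r 8 = σ.r 8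
  r17 : τ.r 17 = σ.r 17
  mat : τ.M = σ.M
  A6 : τ.A 6 = σ.A 6
  part : Partial n eu ev (Ico (t + k) m) (τ.A 5) (τ.A 8) (τ.r 16)
  rem : ∀ C, Proper eu ev (range m) C → code t C (m - t) = σ.r 8 →
    τ.r 9 = code t C k ∧ ∀ i ∈ Ico (t + k) m, τ.A 8 i = C i

lemma OthersInv.congr {τ' : Cfg} {k : ℕ} (h : OthersInv n m t eu ev σ k τ)
    (hr : ∀ j ∈ [5, 6, 7, 8, 9, 16, 17, 18], τ'.r j = τ.r j) (hA : τ'.A = τ.A)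
    (hM : τ'.M = τ.M) : OthersInv n m t eu ev σ k τ' where
  static := h.static.congr (hr _ (by simp)) (hr _ (by simp)) (hr _ (by simp)) (hr _ (by simp))
    fun j _ => by rw [hA]
  r8 := by rw [hr _ (by simp), h.r8]
  r17 := by rw [hr _ (by simp), h.r17]
  mat := by rw [hM, h.mat]
  A6 := by rw [hA, h.A6]
  part := by
    rw [hA, hr _ (by simp)]
    exact h.part
  rem := by
    rw [hA, hr _ (by simp)]
    exact h.rem

lemma runs_colorOther (hE : EdgeList n adj m t eu ev) {k : ℕ} (hk : k < m - t)
    (h : OthersInv n m t eu ev σ (k + 1) τ) (h11 : τ.r 11 = k) (h15 : τ.r 15 = t + k)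
    (hQ : ∀ τ', τ'.r 10 = τ.r 10 → OthersInv n m t eu ev σ k τ' → Q τ') :
    Runs n (readDigit ;; applyColor) τ 2500 Q := by
  obtain ⟨i1, i2, i3, i4, i5, i6, i7⟩ := h
  have hcode : ∀ C, code t C (k + 1) = code t C k + C (t + k) * 3 ^ k := fun C => by
    rw [code, sum_range_succ, code]
  have hnot : t + k ∉ Ico (t + (k + 1)) m := by simp
  have hins : Ico (t + k) m = insert (t + k) (Ico (t + (k + 1)) m) := by
    ext i
    simp only [mem_Ico, mem_insert]
    omega
  have hmem : Ico (t + (k + 1)) m ⊆ range m := fun i => by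
    simp only [mem_Ico, mem_range]
    omega
  have hkm : t + k ∈ range m := mem_range.2 (by omega)
  obtain ⟨hu, hv, -⟩ := hE.lt (t + k) (by omega)
  refine Runs.mono (Runs.seq (runs_readDigit fun τ' t1 t2 t3 t4 t5 =>
    runs_applyColor (eu := eu) (ev := ev) (by rw [t2, i1.eu_eq]) (by rw [t2, i1.ev_eq])
      fun τ'' s1 s2 s3 s4 => ?_)) (by decide) fun _ h => h
  have e15 : τ'.r 15 = t + k := by rw [t1 15 (by norm_num) (by norm_num), h15]
  have e16 : τ'.r 16 = τ.r 16 := t1 16 (by norm_num) (by norm_num)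
  have hreg : ∀ i, i ≠ 9 → i ≠ 12 → i ≠ 13 → i ≠ 14 → i ≠ 16 → τ''.r i = τ.r i := by
    intro i a1 a2 a3 a4 a5
    rw [s1 i a3 a4 a5, t1 i a1 a2]
  rw [e15, e16, t2] at s4
  have digit : ∀ C, Proper eu ev (range m) C → code t C (m - t) = σ.r 8 →
      τ'.r 12 = C (t + k) ∧ τ'.r 9 = code t C k := by
    intro C hC hg
    refine t5 _ _ (hC.le _ hkm) ?_ ?_
    · rw [h11, i1.pow_eq k hk.le]
      exact code_lt fun l hl => hC.le _ (mem_range.2 (by omega))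
    · rw [h11, i1.pow_eq k hk.le, ← hcode]
      exact (i7 C hC hg).1
  refine hQ _ (by simp [hreg]) ⟨i1.congr ?_ ?_ ?_ ?_ ?_, ?_, ?_, ?_, ?_, ?_, ?_⟩
  · simp [hreg]
  · simp [hreg]
  · simp [hreg]
  · simp [hreg]
  · intro i hi
    rw [s2 i (by omega) (by omega), t2]
  · simp [hreg, i2]
  · simp [hreg, i3]
  · rw [s3, t3, i4]
  · rw [s2 _ (by norm_num) (by norm_num), t2, i5]
  · rw [hins]
    rcases s4 with ⟨-, a1, a2, a3⟩ | ⟨b1, b2, a1, a2, a3⟩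
    · rw [a1, a2, a3]
      exact i6.skip hnot
    · rw [a1, a2, a3]
      exact i6.color hnot hu hv t4 b1 b2
  · intro C hC hg
    obtain ⟨d1, d2⟩ := digit C hC hg
    refine ⟨by rw [s1 9 (by norm_num) (by norm_num) (by norm_num), d2], ?_⟩
    have hcol : τ''.A 8 = update (τ.A 8) (t + k) (C (t + k)) := by
      rcases s4 with ⟨b1, a1, a2, a3⟩ | ⟨b1, b2, a1, a2, a3⟩
      · rw [a2]
        congr 1
        by_contra hne
        obtain ⟨f1, f2⟩ := i6.free hnot hu hv hC hmem hkm (i7 C hC hg).2 (Ne.symm hne)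
        rw [d1] at b1
        exact b1.elim f1 f2
      · rw [a2, d1]
    intro i hi
    rw [hcol]
    by_cases hik : i = t + k
    · rw [hik, update_self]
    · rw [update_of_ne hik]
      rw [hins] at hi
      exact (i7 C hC hg).2 i ((mem_insert.1 hi).resolve_left hik)

lemma runs_colorOthers (hE : EdgeList n adj m t eu ev) (hS : Static n m t eu ev σ)
    (hP : Partial n eu ev ∅ (σ.A 5) (σ.A 8) 0)
    (hQ : ∀ τ, OthersInv n m t eu ev σ 0 τ → Q τ) :
    Runs n colorOthers σ (4 + ((m - t) * (3000 + 9) + 7)) Q := by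
  have hle := hE.le
  refine Runs.mono (Runs.seq (Runs.set (by norm_num) (Runs.seq (Runs.set (by norm_num) (Runs.for_
    (T := 3000) (m := m - t)
    (fun j τ => OthersInv n m t eu ev σ (m - t - j) τ) (by norm_num) ?_ ?_ ?_
    fun τ _ hi => hQ τ (by simpa using hi)))))) ?_ fun _ h => h
  · have h1 : Ico (t + (m - t - 0)) m = ∅ := by
      rw [Ico_eq_empty]
      omega
    constructor
    · refine hS.congr ?_ ?_ ?_ ?_ ?_ <;> simp
    · simp
    · simp
    · simp
    · simp
    · rw [h1]
      simpa using hP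
    · intro C _ hC
      rw [h1]
      simp [hC]
  · intro k τ hi
    simp [hi.static.c_eq]
  · rintro j τ hj hr hi
    obtain ⟨k, hk⟩ : ∃ k, m - t - j = k + 1 := ⟨m - t - j - 1, by omega⟩
    have hk' : m - t - (j + 1) = k := by omega
    rw [hk] at hi
    rw [hk']
    refine Runs.mono (Runs.seq (Runs.set (by norm_num) (Runs.seq (Runs.set (by norm_num)
      (runs_colorOther (σ := σ) (k := k) hE (by omega) (hi.congr ?_ ?_ ?_) ?_ ?_ ?_)))))
      (by decide) fun _ h => h
    · simp
    · simp
    · simp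
    · simp [hr, hi.static.c_eq, hk']
    · simp [hr, hi.static.c_eq, hi.static.t_eq, hk']
    · intro τ' h10 h
      refine ⟨by simpa [hr] using h10, h.congr ?_ ?_ ?_⟩ <;> simp
  · simp only [Expr.cost]
    omega

end

end MaxTwoEdgeCol

namespace MaxTwoEdgeCol

open RAM Function Finset

instance (b x : ℕ) : Decidable (Allowed b x) := by
  unfold Allowed
  infer_instance

/-- Compare the best value so far, in the register `20`, with the value of using the color `x`. The
registers `13`, `14` and `19` contain the parent, the child and the set of free colors of the child;
the set of free colors of the parent is `b`. -/
def tryColor (b x : ℕ) : Cmd :=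
  if Allowed b x then
    .ite (.get 5 (quad (.var 14) (.const x)))
      (.set 22 (.add (.add (.get 6 (quad (.var 13) (.const (b - x))))
          (.get 6 (quad (.var 14) (.sub (.var 19) (.const x))))) (.const 1)) ;;
        .ite (.sub (.var 22) (.var 20)) (.set 20 (.var 22) ;; .set 21 (.const x)) .skip) .skip
  else .skip

/-- Compute the table entry of the parent for the set `b` of free colors. The best colors are stored
in the array `7`. -/
def mergeEntry (b : ℕ) : Cmd :=
  .set 20 (.add (.get 6 (quad (.var 13) (.const b))) (.get 6 (quad (.var 14) (.var 19)))) ;;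
  .set 21 (.const 0) ;; tryColor b 1 ;; tryColor b 2 ;;
  .put 6 (quad (.var 13) (.const b)) (.var 20) ;; .put 7 (quad (.var 15) (.const b)) (.var 21)

/-- One step of the dynamic program, for the tree edge numbered by the register `15`. -/
def mergeChild : Cmd :=
  .set 13 (.get 2 (.var 15)) ;; .set 14 (.get 3 (.var 15)) ;; .set 19 (maskExpr 14) ;;
  mergeEntry 3 ;; mergeEntry 2 ;; mergeEntry 1 ;; mergeEntry 0

/-- The dynamic program, which processes the tree edges from the last one to the first one. -/
def computeTables : Cmd :=
  .for_ 10 6 (.set 15 (.sub (.var 6) (.add (.var 10) (.const 1))) ;; mergeChild)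

section
variable {n m t : ℕ} {adj : ℕ → ℕ → Prop} {eu ev : ℕ → ℕ} {σ τ : Cfg} {Q : Cfg → Prop}

/-- The register `20` of `τ` contains the best value among the colors in `xs` and `0`. -/
structure BestInv (b : ℕ) (xs : List ℕ) (σ τ : Cfg) : Prop where
  r : ∀ j, j ≠ 20 → j ≠ 21 → j ≠ 22 → τ.r j = σ.r j
  A : τ.A = σ.A
  M : τ.M = σ.M
  eq : τ.r 20 = cand (σ.A 6) (σ.r 13) (σ.r 14) b (σ.r 19) (τ.r 21)
  allowed : Allowed b (τ.r 21) ∧ Allowed (σ.r 19) (τ.r 21)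
  le : ∀ x ∈ xs, Allowed b x → Allowed (σ.r 19) x →
    cand (σ.A 6) (σ.r 13) (σ.r 14) b (σ.r 19) x ≤ τ.r 20

lemma runs_tryColor {b x : ℕ} {xs : List ℕ} (hx : x ≠ 0)
    (hf : Allowed (σ.r 19) x ↔ σ.A 5 (4 * σ.r 14 + x) ≠ 0) (h : BestInv b xs σ τ)
    (hQ : ∀ τ', BestInv b (x :: xs) σ τ' → Q τ') : Runs n (tryColor b x) τ 2000 Q := by
  obtain ⟨h1, h2, h3, h4, h5, h6⟩ := h
  unfold tryColor
  split_ifs with hb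
  · refine Runs.mono (Runs.ite (fun c1 => Runs.seq (Runs.set (by norm_num) (Runs.ite
      (fun c2 => Runs.seq (Runs.set (by norm_num) (Runs.set (by norm_num) ?_)))
      fun c2 => Runs.skip ?_))) fun c1 => Runs.skip ?_) (by simp [Expr.cost, Expr.addr, Expr.dbl, Expr.get, quad]) fun _ h => h
    · simp [h1, h2] at c1 c2
      refine hQ _ ⟨fun j j1 j2 j3 => by simp [j1, j2, j3, h1], by simp [h2], by simp [h3], ?_, ?_,
        ?_⟩
      · simp [h1, h2, cand, hx]
      · simpa using ⟨hb, hf.2 c1⟩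
      · intro y hy a1 a2
        simp only [Cfg.set_r, Nat.reduceEqDiff, if_true, if_false]
        rcases List.mem_cons.1 hy with rfl | hy
        · simp [h1, h2, cand, hx]
        · refine (h6 y hy a1 a2).trans ?_
          simp [h1, h2]
          omega
    · simp [h1, h2] at c1 c2
      refine hQ _ ⟨fun j j1 j2 j3 => by simp [j3, h1 j j1 j2 j3], by simp [h2], by simp [h3], ?_,
        ?_, ?_⟩
      · simpa using h4
      · simpa using h5
      · intro y hy a1 a2
        simp only [Cfg.set_r, Nat.reduceEqDiff, if_false]
        rcases List.mem_cons.1 hy with rfl | hy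
        · rw [cand, if_neg hx]
          omega
        · exact h6 y hy a1 a2
    · simp [h1, h2] at c1
      refine hQ _ ⟨h1, h2, h3, h4, h5, fun y hy a1 a2 => ?_⟩
      rcases List.mem_cons.1 hy with rfl | hy
      · exact absurd c1 (hf.1 a2)
      · exact h6 y hy a1 a2
  · refine Runs.mono (Runs.skip (hQ _ ⟨h1, h2, h3, h4, h5, fun y hy a1 a2 => ?_⟩)) (by norm_num)
      fun _ h => h
    rcases List.mem_cons.1 hy with rfl | hy
    · exact absurd a1 hb
    · exact h6 y hy a1 a2

/-- The entries for the sets numbered `β` or more of the table `M` are computed. -/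
structure MergeFrom (n p v f β : ℕ) (M M' dec : ℕ → ℕ) : Prop where
  keep : ∀ w < n, w ≠ p → ∀ b < 4, M (4 * w + b) = M' (4 * w + b)
  todo : ∀ b < β, M (4 * p + b) = M' (4 * p + b)
  dec_allowed : ∀ b < 4, β ≤ b → Allowed b (dec b) ∧ Allowed f (dec b)
  eq : ∀ b < 4, β ≤ b → M (4 * p + b) = cand M' p v b f (dec b)
  le : ∀ b < 4, β ≤ b → ∀ x, Allowed b x → Allowed f x → cand M' p v b f x ≤ M (4 * p + b)

/-- The state of `mergeChild`, started in `σ`. -/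
structure MergeInv (n : ℕ) (σ : Cfg) (β : ℕ) (τ : Cfg) : Prop where
  r : ∀ j, j ≠ 20 → j ≠ 21 → j ≠ 22 → τ.r j = σ.r j
  A : ∀ j, j ≠ 6 → j ≠ 7 → τ.A j = σ.A j
  M : τ.M = σ.M
  dec : ∀ a, a < 4 * σ.r 15 ∨ 4 * σ.r 15 + 4 ≤ a → τ.A 7 a = σ.A 7 a
  merge : MergeFrom n (σ.r 13) (σ.r 14) (σ.r 19) β (τ.A 6) (σ.A 6)
    fun b => τ.A 7 (4 * σ.r 15 + b)

lemma Allowed.le {b x : ℕ} (h : Allowed b x) : x ≤ b := by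
  unfold Allowed at h
  omega

lemma Allowed.mem {b x : ℕ} (h : Allowed b x) : x ∈ [2, 1, 0] := by
  simp only [List.mem_cons, List.not_mem_nil]
  unfold Allowed at h
  omega

lemma runs_mergeEntry {b : ℕ} (hb : b < 4) (hv : σ.r 14 < n)
    (hpv : σ.r 13 ≠ σ.r 14) (hf4 : σ.r 19 < 4)
    (hf : ∀ x ≤ 2, x ≠ 0 → (Allowed (σ.r 19) x ↔ σ.A 5 (4 * σ.r 14 + x) ≠ 0))
    (h : MergeInv n σ (b + 1) τ) (hQ : ∀ τ', MergeInv n σ b τ' → Q τ') :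
    Runs n (mergeEntry b) τ 6000 Q := by
  obtain ⟨h1, h2, h3, h4, h5⟩ := h
  have hcand : ∀ x, cand (τ.A 6) (σ.r 13) (σ.r 14) b (σ.r 19) x =
      cand (σ.A 6) (σ.r 13) (σ.r 14) b (σ.r 19) x := by
    intro x
    rw [cand, cand, h5.todo _ (by omega), h5.keep _ hv hpv.symm _ (by omega)]
  have e13 := h1 13 (by norm_num) (by norm_num) (by norm_num)
  have e14 := h1 14 (by norm_num) (by norm_num) (by norm_num)
  have e15 := h1 15 (by norm_num) (by norm_num) (by norm_num)
  have e19 := h1 19 (by norm_num) (by norm_num) (by norm_num)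
  have e5 := h2 5 (by norm_num) (by norm_num)
  refine Runs.mono (Runs.seq (Runs.set (by norm_num) (Runs.seq (Runs.set (by norm_num)
    (Runs.seq (runs_tryColor (b := b) (xs := [0]) (σ := τ) one_ne_zero ?_
      ⟨fun j j1 j2 _ => by simp [j1, j2], by simp, by simp, ?_, ?_, ?_⟩ fun τ₁ g1 =>
    Runs.seq (runs_tryColor two_ne_zero ?_ g1 fun τ₂ g2 =>
    Runs.seq (Runs.put (by norm_num) (Runs.put (by norm_num) (hQ _ ?_))))))))))
    (by simp [Expr.cost, Expr.addr, Expr.dbl, Expr.get, quad]) fun _ h => h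
  · rw [e19, e14, e5]
    exact hf 1 (by norm_num) one_ne_zero
  · simp [cand]
  · simp [Allowed]
  · simp [cand]
  · rw [e19, e14, e5]
    exact hf 2 (by norm_num) two_ne_zero
  · obtain ⟨k1, k2, k3, k4, k5, k6⟩ := g2
    rw [e19] at k5
    have k13 := k1 13 (by norm_num) (by norm_num) (by norm_num)
    have k15 := k1 15 (by norm_num) (by norm_num) (by norm_num)
    simp only [e13, e14, e19, hcand] at k4 k6
    have hA6 : ∀ a, (update (τ.A 6) (4 * σ.r 13 + b) (τ₂.r 20)) a =
        if a = 4 * σ.r 13 + b then τ₂.r 20 else τ.A 6 a := fun a => update_apply ..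
    refine ⟨fun j j1 j2 j3 => by simp [k1 j j1 j2 j3, h1 j j1 j2 j3],
      fun j j1 j2 => by simp [j1, j2, k2, h2], by simp [k3, h3], fun a ha => ?_, ?_⟩
    · simp only [Cfg.put_A, Cfg.put_r, ev_quad, Cfg.ev_var, Cfg.ev_const, Nat.reduceLeDiff,
        Nat.reduceEqDiff, if_true, if_false, k2, k15, e15]
      rw [update_of_ne (by omega), h4 a ha]
    · simp only [Cfg.put_A, Cfg.put_r, ev_quad, Cfg.ev_var, Cfg.ev_const, Nat.reduceLeDiff,
        Nat.reduceEqDiff, if_true, if_false, k2, k13, k15, e13, e15]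
      refine ⟨fun w hw hwp c hc => ?_, fun c hc => ?_, fun c hc hbc => ?_, fun c hc hbc => ?_,
        fun c hc hbc => ?_⟩
      · rw [update_of_ne (by omega), h5.keep w hw hwp c hc]
      · rw [update_of_ne (by omega), h5.todo c (by omega)]
      · rcases Nat.lt_or_eq_of_le hbc with hbc | rfl
        · rw [update_of_ne (by omega)]
          exact h5.dec_allowed c hc hbc
        · rw [update_self]
          exact k5
      · rcases Nat.lt_or_eq_of_le hbc with hbc | rfl
        · rw [update_of_ne (by omega), update_of_ne (by omega)]
          exact h5.eq c hc hbc
        · rw [update_self, update_self]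
          exact k4
      · rcases Nat.lt_or_eq_of_le hbc with hbc | rfl
        · rw [update_of_ne (by omega)]
          exact h5.le c hc hbc
        · rw [update_self]
          intro x a1 a2
          exact k6 x a1.mem a1 a2

end

end MaxTwoEdgeCol

namespace MaxTwoEdgeCol

open RAM Function Finset

/-- Color the tree edges with the colors chosen by the dynamic program. -/
def colorTree : Cmd :=
  .for_ 15 6 (.set 13 (.get 2 (.var 15)) ;;
    .set 12 (.get 7 (quad (.var 15) (maskExpr 13))) ;; applyColor)

/-- Write the coloring into the matrix if it has more colored edges than the best one so far, the
number of which is in the register `17`. -/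
def save : Cmd :=
  .ite (.sub (.var 16) (.var 17))
    (.set 17 (.var 16) ;;
      .for_ 15 5 (.set 13 (.get 2 (.var 15)) ;; .set 14 (.get 3 (.var 15)) ;;
        .putM (cell 13 14) (.get 8 (.var 15)) ;; .putM (cell 14 13) (.get 8 (.var 15))))
    .skip

section
variable {n m t : ℕ} {adj : ℕ → ℕ → Prop} {eu ev : ℕ → ℕ} {σ τ : Cfg} {Q : Cfg → Prop}

lemma runs_mergeChild {i : ℕ} {P : Finset ℕ} {col : ℕ → ℕ} {val : ℕ} (h2 : σ.A 2 = eu)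
    (h3 : σ.A 3 = ev) (h15 : σ.r 15 = i) (hv : ev i < n) (hpv : eu i ≠ ev i)
    (hP : Partial n eu ev P (σ.A 5) col val)
    (hQ : ∀ τ, (∀ j, j ≠ 13 → j ≠ 14 → (j < 19 ∨ 22 < j) → τ.r j = σ.r j) →
      (∀ j, j ≠ 6 → j ≠ 7 → τ.A j = σ.A j) → τ.M = σ.M →
      (∀ a, a < 4 * i ∨ 4 * i + 4 ≤ a → τ.A 7 a = σ.A 7 a) →
      Merge n (eu i) (ev i) (mask (σ.A 5) (ev i)) (τ.A 6) (σ.A 6) (fun b => τ.A 7 (4 * i + b)) →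
      Q τ) : Runs n mergeChild σ 30000 Q := by
  subst h15
  have hstart : ∀ σ' : Cfg, σ' = ((σ.set 13 (eu (σ.r 15))).set 14 (ev (σ.r 15))).set 19
      (mask (σ.A 5) (ev (σ.r 15))) → Runs n (mergeEntry 3 ;; mergeEntry 2 ;; mergeEntry 1 ;;
        mergeEntry 0) σ' 24000 Q := by
    rintro σ' rfl
    set σ' := ((σ.set 13 (eu (σ.r 15))).set 14 (ev (σ.r 15))).set 19
      (mask (σ.A 5) (ev (σ.r 15))) with hσ'
    have e13 : σ'.r 13 = eu (σ.r 15) := by simp [hσ']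
    have e14 : σ'.r 14 = ev (σ.r 15) := by simp [hσ']
    have e15 : σ'.r 15 = σ.r 15 := by simp [hσ']
    have e19 : σ'.r 19 = mask (σ.A 5) (ev (σ.r 15)) := by simp [hσ']
    have eA : σ'.A = σ.A := by simp [hσ']
    have a1 : σ'.r 14 < n := by rwa [e14]
    have a2 : σ'.r 13 ≠ σ'.r 14 := by rwa [e13, e14]
    have a3 : σ'.r 19 < 4 := by
      rw [e19]
      exact hP.mask_lt hv
    have a4 : ∀ x ≤ 2, x ≠ 0 → (Allowed (σ'.r 19) x ↔ σ'.A 5 (4 * σ'.r 14 + x) ≠ 0) := by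
      intro x hx hx0
      rw [e19, e14, eA, hP.allowed_mask_iff hv]
      simp [hx, hx0]
    have h0 : MergeInv n σ' 4 σ' := ⟨fun _ _ _ _ => rfl, fun _ _ _ => rfl, rfl, fun _ _ => rfl,
      fun _ _ _ _ _ => rfl, fun _ _ => rfl, by omega, by omega, by omega⟩
    refine Runs.mono (Runs.seq (runs_mergeEntry (by norm_num) a1 a2 a3 a4 h0 fun τ₁ g1 =>
      Runs.seq (runs_mergeEntry (by norm_num) a1 a2 a3 a4 g1 fun τ₁ g1 =>
      Runs.seq (runs_mergeEntry (by norm_num) a1 a2 a3 a4 g1 fun τ₁ g1 =>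
      runs_mergeEntry (by norm_num) a1 a2 a3 a4 g1 fun τ g => hQ τ ?_ ?_ ?_ ?_ ?_))))
      (by norm_num) fun _ h => h
    · intro j j1 j2 j3
      rw [g.r j (by omega) (by omega) (by omega)]
      simp only [hσ', Cfg.set_r]
      rw [if_neg (by omega), if_neg (by omega), if_neg (by omega)]
    · intro j j1 j2
      rw [g.A j j1 j2, eA]
    · rw [g.M]
      rfl
    · intro a ha
      rw [g.dec a (by rwa [e15]), eA]
    · have := g.merge
      rw [e13, e14, e15, e19, eA] at this
      exact ⟨this.keep, fun b hb => this.dec_allowed b hb (Nat.zero_le _),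
        fun b hb => this.eq b hb (Nat.zero_le _), fun b hb => this.le b hb (Nat.zero_le _)⟩
  refine Runs.mono (Runs.seq (Runs.set (by norm_num) (Runs.seq (Runs.set (by norm_num)
    (Runs.seq (Runs.set (by norm_num) (hstart _ ?_)))))))
    (by simp [Expr.cost, Expr.addr, Expr.dbl, Expr.get, quad, maskExpr]) fun _ h => h
  simp [h2, h3]

lemma runs_computeTables (hE : EdgeList n adj m t eu ev) (hS : Static n m t eu ev σ)
    {P : Finset ℕ} (hP : Partial n eu ev P (σ.A 5) (σ.A 8) (σ.r 16))
    (h6 : ∀ w < n, ∀ b < 4, σ.A 6 (4 * w + b) = 0)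
    (hQ : ∀ τ, Static n m t eu ev τ → τ.r 8 = σ.r 8 → τ.r 16 = σ.r 16 → τ.r 17 = σ.r 17 →
      τ.M = σ.M → τ.A 5 = σ.A 5 → τ.A 8 = σ.A 8 →
      (∃ Ms : ℕ → ℕ → ℕ, (∀ w < n, ∀ b < 4, Ms t (4 * w + b) = 0) ∧
        Tables n t eu ev (σ.A 5) Ms (τ.A 7) 0) → Q τ) :
    Runs n computeTables σ (t * (31000 + 9) + 7) Q := by
  refine Runs.for_ (m := t) (fun j τ => Static n m t eu ev τ ∧ τ.r 8 = σ.r 8 ∧ τ.r 16 = σ.r 16 ∧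
    τ.r 17 = σ.r 17 ∧ τ.M = σ.M ∧ τ.A 5 = σ.A 5 ∧ τ.A 8 = σ.A 8 ∧
    ∃ Ms : ℕ → ℕ → ℕ, Ms (t - j) = τ.A 6 ∧ (∀ w < n, ∀ b < 4, Ms t (4 * w + b) = 0) ∧
      Tables n t eu ev (σ.A 5) Ms (τ.A 7) (t - j)) (by norm_num) ?_ ?_ ?_ ?_
  · refine ⟨hS.congr ?_ ?_ ?_ ?_ ?_, ?_, ?_, ?_, ?_, ?_, ?_, fun _ => σ.A 6, ?_, h6, ?_⟩ <;> simp
    intro j hj hjt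
    omega
  · intro k τ hi
    simp [hi.1.t_eq]
  · rintro j τ hj hr ⟨i1, i2, i3, i4, i5, i6, i7, Ms, i8, i9, i10⟩
    obtain ⟨i, hi⟩ : ∃ i, t - j = i + 1 := ⟨t - j - 1, by omega⟩
    have hi' : t - (j + 1) = i := by omega
    rw [hi] at i8 i10
    rw [hi']
    refine Runs.mono (Runs.seq (Runs.set (by norm_num) (runs_mergeChild (i := i) (eu := eu)
      (ev := ev) (P := P) (col := σ.A 8) (val := σ.r 16) ?_ ?_ ?_ ?_ ?_ ?_
      fun τ' a1 a2 a3 a4 a5 => ?_))) (by simp [Expr.cost]) fun _ h => h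
    · simpa using i1.eu_eq
    · simpa using i1.ev_eq
    · simp [hr, i1.t_eq, hi']
    · exact hE.order.ev_lt i (by omega)
    · exact hE.order.eu_ne i i le_rfl (by omega)
    · simpa [i6] using hP
    · simp only [Cfg.set_A, Cfg.set_M] at a2 a3 a4 a5
      refine ⟨?_, i1.congr ?_ ?_ ?_ ?_ ?_, ?_, ?_, ?_, ?_, ?_, ?_, update Ms i (τ'.A 6), ?_, ?_, ?_⟩
      · simp [a1, hr]
      · simp [a1]
      · simp [a1]
      · simp [a1]
      · simp [a1]
      · intro k hk
        rw [Cfg.set_A, a2 k (by omega) (by omega)]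
      · simp [a1, i2]
      · simp [a1, i3]
      · simp [a1, i4]
      · simp [a3, i5]
      · simp [a2, i6]
      · simp [a2, i7]
      · simp
      · rw [update_of_ne (by omega)]
        exact i9
      · intro k hk hkt
        simp only [Cfg.set_A]
        rcases Nat.lt_or_eq_of_le hk with hk | rfl
        · rw [update_of_ne (by omega), update_of_ne (by omega)]
          obtain ⟨m1, m2, m3, m4⟩ := i10 k hk hkt
          have hd : ∀ b, τ'.A 7 (4 * k + b) = τ.A 7 (4 * k + b) := fun b => a4 _ (by omega)
          exact ⟨m1, by simpa only [hd] using m2, by simpa only [hd] using m3, m4⟩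
        · rw [update_self, update_of_ne (by omega), i8]
          rw [i6] at a5
          exact a5
  · rintro τ - ⟨i1, i2, i3, i4, i5, i6, i7, Ms, i8, i9, i10⟩
    rw [Nat.sub_self] at i10
    exact hQ τ i1 i2 i3 i4 i5 i6 i7 ⟨Ms, i9, i10⟩

lemma potential_eq_zero {Ms : ℕ → ℕ → ℕ} {P : Finset ℕ} {fr col : ℕ → ℕ} {val i : ℕ}
    (h : ∀ w < n, ∀ b < 4, Ms t (4 * w + b) = 0) (hP : Partial n eu ev P fr col val) :
    potential n t ev i (Ms t) fr = 0 := by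
  refine sum_eq_zero fun w hw => ?_
  have hw : w < n := mem_range.1 (mem_of_mem_filter _ hw)
  exact h w hw _ (hP.mask_lt hw)

lemma runs_colorTree (hE : EdgeList n adj m t eu ev) (hS : Static n m t eu ev σ)
    (hP : Partial n eu ev (Ico t m) (σ.A 5) (σ.A 8) (σ.r 16)) {Ms : ℕ → ℕ → ℕ}
    (hMs : ∀ w < n, ∀ b < 4, Ms t (4 * w + b) = 0)
    (hT : Tables n t eu ev (σ.A 5) Ms (σ.A 7) 0)
    (hQ : ∀ τ, Static n m t eu ev τ → τ.r 8 = σ.r 8 → τ.r 17 = σ.r 17 →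
      τ.M = σ.M → Partial n eu ev (range m) (τ.A 5) (τ.A 8) (τ.r 16) →
      τ.r 16 = σ.r 16 + potential n t ev 0 (Ms 0) (σ.A 5) → Q τ) :
    Runs n colorTree σ (t * (13000 + 9) + 7) Q := by
  refine Runs.for_ (m := t) (fun i τ => Static n m t eu ev τ ∧ τ.r 8 = σ.r 8 ∧
    τ.r 17 = σ.r 17 ∧ τ.M = σ.M ∧ τ.A 7 = σ.A 7 ∧
    Descent n t eu ev (Ico t m) (σ.A 5) i (τ.A 5) (τ.A 8) (τ.r 16) ∧
    τ.r 16 + potential n t ev i (Ms i) (τ.A 5) = σ.r 16 + potential n t ev 0 (Ms 0) (σ.A 5))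
    (by norm_num) ?_ ?_ ?_ ?_
  · refine ⟨hS.congr ?_ ?_ ?_ ?_ ?_, ?_, ?_, ?_, ?_, ⟨?_, ?_⟩, ?_⟩ <;> simp
    exact hP
  · intro k τ hi
    simp [hi.1.t_eq]
  · rintro i τ hi hr ⟨i1, i2, i3, i4, i5, i6, i7⟩
    refine Runs.mono (Runs.seq (Runs.set (by norm_num) (Runs.seq (Runs.set (by norm_num)
      (runs_applyColor (eu := eu) (ev := ev) ?_ ?_ fun τ' a1 a2 a3 a4 => ?_)))))
      (by simp [Expr.cost, Expr.addr, Expr.dbl, Expr.get, quad, maskExpr]) fun _ h => h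
    · simpa using i1.eu_eq
    · simpa using i1.ev_eq
    · have hstep := i6.step hE.order (i := i) (by simp; omega) hi (Ms := Ms) (dec := σ.A 7)
        (fun j _ => hT j (Nat.zero_le _)) rfl
      have hreg : ∀ j, j ≠ 12 → j ≠ 13 → j ≠ 14 → j ≠ 16 → τ'.r j = τ.r j := by
        intro j j1 j2 j3 j4
        rw [a1 j j2 j3 j4]
        simp [j1, j2]
      simp [hr, i1.eu_eq, i5] at a4
      simp only [Cfg.set_A, Cfg.set_M] at a2 a3
      have main : Descent n t eu ev (Ico t m) (σ.A 5) (i + 1) (τ'.A 5) (τ'.A 8) (τ'.r 16) ∧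
          τ'.r 16 + potential n t ev (i + 1) (Ms (i + 1)) (τ'.A 5) =
            σ.r 16 + potential n t ev 0 (Ms 0) (σ.A 5) := by
        rcases a4 with ⟨b1, b2, b3, b4⟩ | ⟨b1, b2, b3, b4, b5⟩
        · obtain ⟨c1, c2⟩ := hstep.1 b1
          rw [b2, b3, b4, c2]
          exact ⟨c1, i7⟩
        · obtain ⟨c1, c2⟩ := hstep.2 b1 b2
          rw [b3, b4, b5]
          refine ⟨c1, ?_⟩
          omega
      refine ⟨by simp [hreg, hr], i1.congr ?_ ?_ ?_ ?_ ?_, ?_, ?_, ?_, ?_, ?_, ?_⟩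
      · simp [hreg]
      · simp [hreg]
      · simp [hreg]
      · simp [hreg]
      · intro k hk
        rw [Cfg.set_A, a2 k (by omega) (by omega)]
      · simp [hreg, i2]
      · simp [hreg, i3]
      · simp [a3, i4]
      · simp [a2, i5]
      · simpa using main.1
      · simpa using main.2
  · rintro τ - ⟨i1, i2, i3, i4, i5, i6, i7⟩
    have hU : Ico t m ∪ range t = range m := by
      ext i
      have := hE.le
      simp only [mem_union, mem_Ico, mem_range]
      omega
    have hp := i6.part
    rw [hU] at hp
    refine hQ τ i1 i2 i3 i4 hp ?_
    rw [potential_eq_zero hMs hp] at i7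
    exact i7

/-- The matrix contains the coloring `col` of the edges. -/
structure Output (n m : ℕ) (eu ev col mat : ℕ → ℕ) : Prop where
  edge : ∀ i < m, mat (eu i * n + ev i) = col i ∧ mat (ev i * n + eu i) = col i
  other : ∀ u < n, ∀ v < n, (∀ i < m, ¬ SamePair (eu i) (ev i) u v) → mat (u * n + v) = 0

lemma runs_write (hE : EdgeList n adj m t eu ev) (hS : Static n m t eu ev σ) {col : ℕ → ℕ}
    (hO : Output n m eu ev col σ.M)
    (hQ : ∀ τ, Static n m t eu ev τ → τ.r 8 = σ.r 8 → τ.r 17 = σ.r 17 →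
      Output n m eu ev (σ.A 8) τ.M → Q τ) :
    Runs n (.for_ 15 5 (.set 13 (.get 2 (.var 15)) ;; .set 14 (.get 3 (.var 15)) ;;
        .putM (cell 13 14) (.get 8 (.var 15)) ;; .putM (cell 14 13) (.get 8 (.var 15)))) σ
      (m * (300 + 9) + 7) Q := by
  refine Runs.for_ (m := m) (fun k τ => Static n m t eu ev τ ∧ τ.r 8 = σ.r 8 ∧
    τ.r 17 = σ.r 17 ∧ τ.A = σ.A ∧
    (∀ i < k, τ.M (eu i * n + ev i) = σ.A 8 i ∧ τ.M (ev i * n + eu i) = σ.A 8 i) ∧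
    ∀ u < n, ∀ v < n, (∀ i < m, ¬ SamePair (eu i) (ev i) u v) → τ.M (u * n + v) = 0)
    (by norm_num) ?_ ?_ ?_ ?_
  · refine ⟨hS.congr ?_ ?_ ?_ ?_ ?_, ?_, ?_, ?_, ?_, ?_⟩ <;> simp
    exact hO.other
  · intro k τ hi
    simp [hi.1.m_eq]
  · rintro k τ hk hr ⟨i1, i2, i3, i4, i5, i6⟩
    obtain ⟨hu, hv, -⟩ := hE.lt k hk
    have heu : τ.A 2 k = eu k := by rw [i1.eu_eq]
    have hev : τ.A 3 k = ev k := by rw [i1.ev_eq]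
    refine Runs.mono (Runs.seq (Runs.set (by norm_num) (Runs.seq (Runs.set (by norm_num)
      (Runs.seq (Runs.putM ?_ (Runs.putM ?_ ?_))))))) (Nat.le_of_ble_eq_true rfl) fun _ h => h
    · rw [ev_cell (by norm_num) (by norm_num) (by simpa using i1.rows) (by simp [hr, heu, hu])]
      simpa [hr, heu, hev] using cell_lt hu hv
    · rw [ev_cell (by norm_num) (by norm_num) (by simpa using i1.rows) (by simp [hr, hev, hv])]
      simpa [hr, heu, hev] using cell_lt hv hu
    · rw [ev_cell (by norm_num) (by norm_num) (by simpa using i1.rows) (by simp [hr, heu, hu]),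
        ev_cell (by norm_num) (by norm_num) (by simpa using i1.rows) (by simp [hr, hev, hv])]
      classical
      have key : ∀ u v, u < n → v < n → ∀ a, (update (update τ.M (eu k * n + ev k) a)
          (ev k * n + eu k) a) (u * n + v) =
          if SamePair (eu k) (ev k) u v then a else τ.M (u * n + v) := by
        intro u v hu' hv' a
        simp only [update_apply, cell_inj hv' hv, cell_inj hv' hu]
        unfold SamePair
        split_ifs <;> first | rfl | omega
      refine ⟨by simp [hr], i1.congr ?_ ?_ ?_ ?_ ?_, ?_, ?_, ?_, ?_, ?_⟩
      · simp
      · simp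
      · simp
      · simp
      · simp
      · simpa using i2
      · simpa using i3
      · simpa using i4
      · intro i hi
        have hik := hE.lt i (by omega)
        simp [hr, heu, hev, key _ _ hik.1 hik.2.1, key _ _ hik.2.1 hik.1]
        rcases Nat.lt_succ_iff_lt_or_eq.1 hi with hi | rfl
        · have hne := hE.inj i k hi hk
          have h1 : ¬ SamePair (eu k) (ev k) (eu i) (ev i) := by
            unfold SamePair at *
            omega
          have h2 : ¬ SamePair (eu k) (ev k) (ev i) (eu i) := by
            unfold SamePair at *
            omega
          rw [if_neg h1, if_neg h2]
          exact i5 i hi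
        · simp [SamePair, i4]
      · intro u hu' v hv' h
        simp [hr, heu, hev, key _ _ hu' hv']
        rw [if_neg (h k hk)]
        exact i6 u hu' v hv' h
  · rintro τ - ⟨i1, i2, i3, i4, i5, i6⟩
    exact hQ τ i1 i2 i3 ⟨i5, i6⟩

/-- The invariant of the search: the matrix contains a proper coloring, and no coloring with a code
less than `g` is better. -/
structure SearchInv (n m t : ℕ) (eu ev : ℕ → ℕ) (g : ℕ) (τ : Cfg) : Prop where
  static : Static n m t eu ev τ
  best : ∃ col, Proper eu ev (range m) col ∧ Output n m eu ev col τ.M ∧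
    τ.r 17 = numColored (range m) col
  le : ∀ C, Proper eu ev (range m) C → code t C (m - t) < g → numColored (range m) C ≤ τ.r 17

lemma runs_save (hE : EdgeList n adj m t eu ev) {g : ℕ} (h : SearchInv n m t eu ev g τ)
    (hP : Partial n eu ev (range m) (τ.A 5) (τ.A 8) (τ.r 16))
    (hg : ∀ C, Proper eu ev (range m) C → code t C (m - t) = g →
      numColored (range m) C ≤ τ.r 16)
    (hQ : ∀ τ', τ'.r 8 = τ.r 8 → SearchInv n m t eu ev (g + 1) τ' → Q τ') :
    Runs n save τ (m * (300 + 9) + 20) Q := by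
  obtain ⟨h1, ⟨col, h2, h3, h4⟩, h5⟩ := h
  refine Runs.mono (Runs.ite (fun c1 => Runs.seq (Runs.set (by norm_num) (runs_write (m := m)
    (t := t) (eu := eu) (ev := ev) (adj := adj) hE (h1.congr ?_ ?_ ?_ ?_ ?_) (col := col) ?_
    fun τ' a1 a2 a3 a4 => hQ τ' ?_ ⟨a1, ⟨τ.A 8, hP.proper, ?_, ?_⟩, fun C hC hlt => ?_⟩)))
    fun c1 => Runs.skip (hQ τ rfl ⟨h1, ⟨col, h2, h3, h4⟩, fun C hC hlt => ?_⟩)) ?_ fun _ h => h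
  · simp
  · simp
  · simp
  · simp
  · simp
  · simpa using h3
  · simpa using a2
  · simpa using a4
  · simpa [a3] using hP.val_eq
  · simp at a3
    simp [Nat.sub_eq_zero_iff_le] at c1
    rw [a3]
    rcases Nat.lt_succ_iff_lt_or_eq.1 hlt with hlt | heq
    · exact (h5 C hC hlt).trans c1.le
    · exact hg C hC heq
  · simp [Nat.sub_eq_zero_iff_le] at c1
    rcases Nat.lt_succ_iff_lt_or_eq.1 hlt with hlt | heq
    · exact h5 C hC hlt
    · exact (hg C hC heq).trans c1
  · simp only [Expr.cost]
    omega

/-- Compute the best coloring that agrees with the ternary digits of the register `8` outside the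
tree. -/
def tryCode : Cmd := initTables ;; colorOthers ;; computeTables ;; colorTree ;; save

/-- The number of steps of `tryCode`. -/
def tryTime (n m t : ℕ) : ℕ :=
  n * (4000 + 9) + 7 + (4 + ((m - t) * (3000 + 9) + 7) + (t * (31000 + 9) + 7 +
    (t * (13000 + 9) + 7 + (m * (300 + 9) + 20))))

lemma runs_tryCode (hE : EdgeList n adj m t eu ev) {g : ℕ} (h : SearchInv n m t eu ev g σ)
    (h8 : σ.r 8 = g) (hQ : ∀ τ', τ'.r 8 = g → SearchInv n m t eu ev (g + 1) τ' → Q τ') :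
    Runs n tryCode σ (tryTime n m t) Q := by
  refine Runs.seq (runs_initTables (eu := eu) (ev := ev) fun σ₁ a1 a2 a3 a4 a5 =>
    Runs.seq (runs_colorOthers hE (h.static.congr ?_ ?_ ?_ ?_ ?_) a4 fun σ₂ b =>
    Runs.seq (runs_computeTables hE b.static b.part (b.A6 ▸ a5)
      fun σ₃ c1 c2 c3 c4 c5 c6 c7 ⟨Ms, c8, c9⟩ =>
    Runs.seq (runs_colorTree hE c1 ?_ c8 (c6 ▸ c9) fun σ₄ d1 d2 d3 d4 d5 d6 =>
    runs_save hE (g := g) ⟨d1, ?_, ?_⟩ d5 ?_ ?_))))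
  · simp [a1]
  · simp [a1]
  · simp [a1]
  · simp [a1]
  · intro j hj
    rw [a2 j (by omega) (by omega)]
  · rw [c6, c7, c3]
    exact b.part
  · rw [d4, c5, b.mat, a3, d3, c4, b.r17, a1 17 (by norm_num)]
    exact h.best
  · rw [d3, c4, b.r17, a1 17 (by norm_num)]
    exact h.le
  · intro C hC hg
    have hU : Ico (t + 0) m ∪ range t = range m := by
      ext i
      have := hE.le
      simp only [mem_union, mem_Ico, mem_range]
      omega
    have := numColored_le_potential hE.order c9 b.part (fun i hi => by simp; omega)
      (C := C) (by rwa [hU]) (b.rem C hC (by rw [hg, a1 8 (by norm_num), h8])).2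
    rwa [hU, ← c3, ← c6, ← d6] at this
  · intro τ' e1 e2
    refine hQ τ' ?_ e2
    rw [e1, d2, c2, b.r8, a1 8 (by norm_num), h8]

/-- Search for the best coloring. -/
def search : Cmd := .for_ 8 18 tryCode

lemma runs_search (hE : EdgeList n adj m t eu ev) (h : Static n m t eu ev σ)
    (hM : ∀ u < n, ∀ v < n, σ.M (u * n + v) = 0) (h17 : σ.r 17 = 0)
    (hQ : ∀ τ col, Proper eu ev (range m) col → Output n m eu ev col τ.M →
      (∀ C, Proper eu ev (range m) C → numColored (range m) C ≤ numColored (range m) col) → Q τ) :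
    Runs n search σ (3 ^ (m - t) * (tryTime n m t + 9) + 7) Q := by
  have hreg : ∀ g τ k, SearchInv n m t eu ev g τ → SearchInv n m t eu ev g (τ.set 8 k) := by
    rintro g τ k ⟨h1, h2, h3⟩
    refine ⟨h1.congr ?_ ?_ ?_ ?_ ?_, ?_, ?_⟩ <;> simp
    · exact h2
    · exact h3
  refine Runs.for_ (m := 3 ^ (m - t)) (SearchInv n m t eu ev) (by norm_num) (hreg _ _ _ ⟨h,
    ⟨fun _ => 0, ⟨by simp, by simp⟩, ⟨fun i hi => ?_, fun u hu v hv _ => hM u hu v hv⟩, ?_⟩,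
    by simp⟩) ?_ ?_ ?_
  · obtain ⟨hu, hv, -⟩ := hE.lt i hi
    exact ⟨hM _ hu _ hv, hM _ hv _ hu⟩
  · simp [h17, numColored]
  · intro k τ hi
    simp [hi.static.total_eq]
  · intro k τ hk hr hi
    exact runs_tryCode hE hi hr fun τ' h1 h2 => ⟨h1, hreg _ _ _ h2⟩
  · rintro τ - ⟨-, ⟨col, h2, h3, h4⟩, h5⟩
    refine hQ τ col h2 h3 fun C hC => ?_
    rw [← h4]
    refine h5 C hC (code_lt fun l hl => hC.le _ (mem_range.2 ?_))
    have := hE.le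
    omega

end

end MaxTwoEdgeCol

namespace MaxTwoEdgeCol

open RAM Function Finset

/-- Store the square of the register `0` in the register `1`. -/
def square : Cmd :=
  .loop (.sub (.var 0) (.var 2)) (.set 1 (.add (.var 1) (.var 0)) ;;
    .set 2 (.add (.var 2) (.const 1)))

/-- The program that solves the maximum 2-edge-colorable subgraph problem on connected graphs. -/
def solve : Cmd := square ;; setup ;; search

section
variable {n m t : ℕ} {G : SimpleGraph (Fin n)} {eu ev : ℕ → ℕ}

lemma exec_square (n : ℕ) (mem : ℕ → ℕ) (l k : ℕ) (hk : k + l = n) :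
    Exec square
      ⟨fun x => if x = 0 then n else if x = 1 then k * n else if x = 2 then k else 0, mem⟩
      ⟨fun x => if x = 0 then n else if x = 1 then n * n else if x = 2 then n else 0, mem⟩
      (l * 12 + 4) := by
  induction l generalizing k with
  | zero =>
    obtain rfl : k = n := by omega
    exact Exec.loop_stop (by simp [Expr.eval])
  | succ l ih =>
    unfold square at ih ⊢
    have h := Exec.loop_step (b := .sub (.var 0) (.var 2)) (s₁ := ⟨fun x => if x = 0 then n else
      if x = 1 then k * n else if x = 2 then k else 0, mem⟩) (by simp [Expr.eval]; omega)
      (Exec.seq (Exec.assign _ 1 (.add (.var 1) (.var 0)))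
        (Exec.assign _ 2 (.add (.var 2) (.const 1)))) (s₃ := ⟨fun x => if x = 0 then n else
      if x = 1 then n * n else if x = 2 then n else 0, mem⟩) (t₂ := l * 12 + 4)
      (by
        convert ih (k + 1) (by omega) using 2
        funext x
        simp only [Expr.eval, update_apply]
        rcases x with _ | _ | _ | x <;> simp
        ring)
    convert h using 1
    simp only [Expr.cost]
    omega

lemma exists_eq_toState (G : SimpleGraph (Fin n)) : ∃ σ : Cfg,
    Exec square (initState G) (σ.toState n) (n * 12 + 4) ∧ (∀ j i, σ.A j i = 0) ∧
      σ.M = (initState G).mem := by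
  refine ⟨⟨fun x => if x = 2 then n else 0, fun _ _ => 0, (initState G).mem⟩, ?_,
    fun _ _ => rfl, rfl⟩
  convert exec_square n (initState G).mem n 0 (by omega) using 1
  · simp only [initState, State.mk.injEq, and_true]
    funext x
    simp
  · simp only [Cfg.toState, State.mk.injEq, true_and]
    funext a
    split_ifs with h
    · rfl
    · simp only [initState]
      rw [if_neg]
      rintro ⟨i, j, rfl, -⟩
      exact h (cell_lt i.2 j.2)

/-- The adjacency relation of `G`, on the natural numbers. -/
def natAdj (G : SimpleGraph (Fin n)) (u v : ℕ) : Prop :=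
  ∃ (hu : u < n) (hv : v < n), G.Adj ⟨u, hu⟩ ⟨v, hv⟩

lemma natAdj_val (G : SimpleGraph (Fin n)) (i j : Fin n) : natAdj G i j ↔ G.Adj i j :=
  ⟨fun ⟨_, _, h⟩ => h, fun h => ⟨i.2, j.2, h⟩⟩

lemma initState_mem_ne_zero {u v : ℕ} (hu : u < n) (hv : v < n) :
    (initState G).mem (u * n + v) ≠ 0 ↔ natAdj G u v := by
  simp only [initState, ne_eq, ite_eq_right_iff, one_ne_zero, imp_false, not_not]
  constructor
  · rintro ⟨i, j, h, hadj⟩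
    obtain ⟨rfl, rfl⟩ := (cell_inj hv j.2).1 h
    exact ⟨hu, hv, hadj⟩
  · rintro ⟨hu, hv, hadj⟩
    exact ⟨⟨u, hu⟩, ⟨v, hv⟩, rfl, hadj⟩

lemma reachIn_mono {adj : ℕ → ℕ → Prop} {r s w : ℕ} (hrs : r ≤ s) (h : ReachIn adj r w) :
    ReachIn adj s w := by
  induction hrs with
  | refl => exact h
  | step _ ih => exact Or.inl ih

lemma reachIn_walk {a b : Fin n} (p : G.Walk a b) {r : ℕ} (h : ReachIn (natAdj G) r a) :
    ReachIn (natAdj G) (r + p.length) b := by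
  induction p generalizing r with
  | nil => exact h
  | cons hadj p ih =>
    have := ih (r := r + 1) (Or.inr ⟨_, h, (natAdj_val G _ _).2 hadj⟩)
    rw [SimpleGraph.Walk.length_cons]
    convert this using 1
    omega

lemma reachIn_of_connected (hG : G.Connected) {w : ℕ} (hw : w < n) :
    ReachIn (natAdj G) n w := by
  obtain ⟨p, hp⟩ := (hG.preconnected ⟨0, by omega⟩ ⟨w, hw⟩).exists_isPath
  have h1 := hp.length_lt
  rw [Fintype.card_fin] at h1
  have h2 := reachIn_walk p (r := 0) rfl
  exact reachIn_mono (by omega) h2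

lemma SamePair.swap {a b c d : ℕ} (h : SamePair a b c d) : SamePair a b d c := Or.symm h

open Classical in
/-- The number of edges of a subgraph, counted by means of the list of edges. -/
lemma ncard_edgeSet_eq (hE : EdgeList n (natAdj G) m t eu ev) {H : SimpleGraph (Fin n)}
    (hH : H ≤ G) : H.edgeSet.ncard = #{i ∈ range m | natAdj H (eu i) (ev i)} := by
  have hn : NeZero n := ⟨by have := hE.card; omega⟩
  have hval : ∀ i < m, ((Fin.ofNat n (eu i) : Fin n) : ℕ) = eu i ∧
      ((Fin.ofNat n (ev i) : Fin n) : ℕ) = ev i := fun i hi =>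
    ⟨Nat.mod_eq_of_lt (hE.lt i hi).1, Nat.mod_eq_of_lt (hE.lt i hi).2.1⟩
  have hadj : ∀ i < m, (H.Adj (Fin.ofNat n (eu i)) (Fin.ofNat n (ev i)) ↔
      natAdj H (eu i) (ev i)) := fun i hi => by
    rw [← natAdj_val, (hval i hi).1, (hval i hi).2]
  have himg : H.edgeSet = (fun i => s(Fin.ofNat n (eu i), Fin.ofNat n (ev i))) ''
      ({i ∈ range m | natAdj H (eu i) (ev i)} : Finset ℕ) := by
    ext e
    induction e using Sym2.ind with
    | _ a b =>
      rw [SimpleGraph.mem_edgeSet, Set.mem_image]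
      constructor
      · intro h
        obtain ⟨i, hi, hs⟩ := hE.complete a b ((natAdj_val G a b).2 (hH h))
        refine ⟨i, ?_, ?_⟩
        · rw [coe_filter, Set.mem_ofPred_eq, mem_range]
          refine ⟨hi, ?_⟩
          rcases hs with ⟨h1, h2⟩ | ⟨h1, h2⟩
          · rw [h1, h2, natAdj_val]
            exact h
          · rw [h1, h2, natAdj_val]
            exact h.symm
        · rcases hs with ⟨h1, h2⟩ | ⟨h1, h2⟩
          · simp only [h1, h2, Fin.ofNat_val_eq_self]
          · simp only [h1, h2, Fin.ofNat_val_eq_self]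
            exact Sym2.eq_swap
      · rintro ⟨i, hi, he⟩
        rw [coe_filter, Set.mem_ofPred_eq, mem_range] at hi
        rw [← SimpleGraph.mem_edgeSet, ← he, SimpleGraph.mem_edgeSet, hadj i hi.1]
        exact hi.2
  rw [himg, Set.InjOn.ncard_image, Set.ncard_coe_finset]
  have key : ∀ i j, i < j → j < m → s(Fin.ofNat n (eu i), Fin.ofNat n (ev i)) ≠
      s(Fin.ofNat n (eu j), Fin.ofNat n (ev j)) := by
    intro i j hij hj he
    refine hE.inj i j hij hj ?_
    rw [Sym2.eq_iff] at he
    rw [← (hval i (by omega)).1, ← (hval i (by omega)).2, ← (hval j hj).1, ← (hval j hj).2]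
    rcases he with ⟨h1, h2⟩ | ⟨h1, h2⟩
    · exact Or.inl ⟨by rw [h1], by rw [h2]⟩
    · exact Or.inr ⟨by rw [h1], by rw [h2]⟩
  intro i hi j hj hij
  rw [coe_filter, Set.mem_ofPred_eq, mem_range] at hi hj
  rcases Nat.lt_trichotomy i j with hlt | he | hlt
  · exact absurd hij (key i j hlt hj.1)
  · exact he
  · exact absurd hij.symm (key j i hlt hi.1)

lemma EdgeList.card_edges (hE : EdgeList n (natAdj G) m t eu ev) : m = G.edgeSet.ncard := by
  classical
  rw [ncard_edgeSet_eq hE le_rfl, filter_true_of_mem, card_range]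
  intro i hi
  exact (hE.lt i (mem_range.1 hi)).2.2

/-- A 2-edge-colorable subgraph yields a proper coloring of the listed edges. -/
lemma exists_proper (hE : EdgeList n (natAdj G) m t eu ev) {H : SimpleGraph (Fin n)} (hH : H ≤ G)
    (hc : EdgeColorable H 2) :
    ∃ C, Proper eu ev (range m) C ∧ numColored (range m) C = H.edgeSet.ncard := by
  classical
  obtain ⟨c⟩ := hc
  let C : ℕ → ℕ := fun i => if h : natAdj H (eu i) (ev i) then
    (c ⟨s(⟨eu i, h.1⟩, ⟨ev i, h.2.1⟩), h.2.2⟩ : ℕ) + 1 else 0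
  have hC : ∀ i, C i ≠ 0 ↔ natAdj H (eu i) (ev i) := by
    intro i
    simp only [C]
    split_ifs with h <;> simp [h]
  refine ⟨C, ⟨fun i hi => ?_, fun i hi j hj hij hs he => ?_⟩, ?_⟩
  · simp only [C]
    split_ifs with h
    · omega
    · omega
  · by_contra h0
    have hi' := (hC i).1 h0
    have hj' := (hC j).1 (he ▸ h0)
    simp only [C, dif_pos hi', dif_pos hj'] at he
    have hne : ¬ SamePair (eu i) (ev i) (eu j) (ev j) := by
      rcases Nat.lt_or_gt_of_ne hij with hlt | hlt
      · exact hE.inj i j hlt (mem_range.1 hj)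
      · intro h
        refine hE.inj j i hlt (mem_range.1 hi) ?_
        unfold SamePair at *
        omega
    refine c.valid (v := ⟨s(⟨eu i, hi'.1⟩, ⟨ev i, hi'.2.1⟩), hi'.2.2⟩)
      (w := ⟨s(⟨eu j, hj'.1⟩, ⟨ev j, hj'.2.1⟩), hj'.2.2⟩) ?_ (Fin.ext (by omega))
    rw [SimpleGraph.lineGraph_adj_iff_exists]
    constructor
    · intro h
      have h := Sym2.eq_iff.1 (congrArg Subtype.val h)
      simp only [Fin.mk.injEq] at h
      exact hne h
    · rcases hs with h | h | h | h
      · exact ⟨⟨eu i, hi'.1⟩, by simp, by simp [h]⟩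
      · exact ⟨⟨eu i, hi'.1⟩, by simp, by simp [h]⟩
      · exact ⟨⟨ev i, hi'.2.1⟩, by simp, by simp [h]⟩
      · exact ⟨⟨ev i, hi'.2.1⟩, by simp, by simp [h]⟩
  · rw [ncard_edgeSet_eq hE hH, numColored]
    congr 1
    exact filter_congr fun i _ => hC i

lemma Output.cases {col mat : ℕ → ℕ} (h : Output n m eu ev col mat) {u v : ℕ} (hu : u < n)
    (hv : v < n) (h0 : mat (u * n + v) ≠ 0) :
    ∃ i < m, SamePair (eu i) (ev i) u v ∧ mat (u * n + v) = col i := by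
  by_contra! hc
  refine h0 (h.other u hu v hv fun i hi hs => hc i hi hs ?_)
  rcases hs with ⟨h1, h2⟩ | ⟨h1, h2⟩
  · rw [← h1, ← h2]
    exact (h.edge i hi).1
  · rw [← h1, ← h2]
    exact (h.edge i hi).2

lemma Output.symm {col mat : ℕ → ℕ} (h : Output n m eu ev col mat) {u v : ℕ} (hu : u < n)
    (hv : v < n) : mat (u * n + v) = mat (v * n + u) := by
  by_cases hc : ∃ i < m, SamePair (eu i) (ev i) u v
  · obtain ⟨i, hi, ⟨rfl, rfl⟩ | ⟨rfl, rfl⟩⟩ := hc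
    · rw [(h.edge i hi).1, (h.edge i hi).2]
    · rw [(h.edge i hi).1, (h.edge i hi).2]
  · push Not at hc
    rw [h.other u hu v hv hc, h.other v hv u hu fun i hi hs => hc i hi hs.swap]

/-- An optimal coloring of the listed edges describes a maximum 2-edge-colorable subgraph. -/
lemma exists_describes (hE : EdgeList n (natAdj G) m t eu ev) {σ : Cfg} {col : ℕ → ℕ}
    (hcol : Proper eu ev (range m) col) (hO : Output n m eu ev col σ.M)
    (hmax : ∀ C, Proper eu ev (range m) C →
      numColored (range m) C ≤ numColored (range m) col) :
    ∃ (H : SimpleGraph (Fin n)) (C : H.lineGraph.Coloring (Fin 2)),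
      IsMaxEdgeColorable G H 2 ∧ Describes (σ.toState n) H C := by
  classical
  have hmem : ∀ i j : Fin n, (σ.toState n).mem ((i : ℕ) * n + j) = σ.M ((i : ℕ) * n + j) :=
    fun i j => if_pos (cell_lt i.2 j.2)
  have hadj : ∀ u v, u < n → v < n → σ.M (u * n + v) ≠ 0 → natAdj G u v := by
    intro u v hu hv h
    obtain ⟨i, hi, ⟨rfl, rfl⟩ | ⟨rfl, rfl⟩, -⟩ := hO.cases hu hv h
    · exact (hE.lt i hi).2.2
    · obtain ⟨h1, h2, h3⟩ := (hE.lt i hi).2.2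
      exact ⟨h2, h1, h3.symm⟩
  let H : SimpleGraph (Fin n) :=
    { Adj := fun i j => σ.M ((i : ℕ) * n + j) ≠ 0
      symm := ⟨fun i j h => by rwa [← hO.symm i.2 j.2]⟩
      loopless := ⟨fun i h => G.loopless.irrefl i ((natAdj_val G i i).1 (hadj _ _ i.2 i.2 h))⟩ }
  have hHG : H ≤ G := fun i j h => (natAdj_val G i j).1 (hadj _ _ i.2 j.2 h)
  let value : Sym2 (Fin n) → ℕ :=
    Sym2.lift ⟨fun i j => σ.M ((i : ℕ) * n + j), fun i j => hO.symm i.2 j.2⟩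
  have hcases : ∀ e ∈ H.edgeSet, ∃ k < m, value e = col k ∧ col k ≠ 0 ∧
      ∀ v ∈ e, ((v : ℕ) = eu k ∨ (v : ℕ) = ev k) ∧ ∀ w ∈ e, v ≠ w →
        SamePair (eu k) (ev k) v w := by
    intro e
    induction e using Sym2.ind with
    | _ i j =>
      intro h
      obtain ⟨k, hk, hs, he⟩ := hO.cases i.2 j.2 h
      refine ⟨k, hk, he, he ▸ h, fun v hv => ⟨?_, fun w hw hvw => ?_⟩⟩
      · rcases Sym2.mem_iff.1 hv with rfl | rfl
        · unfold SamePair at hs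
          omega
        · unfold SamePair at hs
          omega
      · rcases Sym2.mem_iff.1 hv with rfl | rfl <;> rcases Sym2.mem_iff.1 hw with rfl | rfl
        · exact absurd rfl hvw
        · exact hs
        · exact hs.swap
        · exact absurd rfl hvw
  have hval2 : ∀ e ∈ H.edgeSet, value e ≠ 0 ∧ value e ≤ 2 := by
    intro e he
    obtain ⟨k, hk, h1, h2, -⟩ := hcases e he
    rw [h1]
    exact ⟨h2, hcol.le k (mem_range.2 hk)⟩
  let C : H.lineGraph.Coloring (Fin 2) := SimpleGraph.Coloring.mk
    (fun e => ⟨value e - 1, by have := hval2 e e.2; omega⟩) (by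
      rintro ⟨e, he⟩ ⟨e', he'⟩ h hc
      rw [SimpleGraph.lineGraph_adj_iff_exists] at h
      obtain ⟨hne, v, hv, hv'⟩ := h
      have a1 := hval2 e he
      have a2 := hval2 e' he'
      simp only [Fin.mk.injEq] at hc
      obtain ⟨k, hk, h1, h2, h3⟩ := hcases e he
      obtain ⟨k', hk', h1', h2', h3'⟩ := hcases e' he'
      have b1 := (h3 v hv).1
      have b2 := (h3' v hv').1
      by_cases hkk : k = k'
      · subst hkk
        apply hne
        obtain ⟨w, rfl⟩ := hv
        obtain ⟨w', rfl⟩ := hv'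
        have c1 := (h3 v (by simp)).2 w (by simp) (by rintro rfl; exact H.irrefl he)
        have c2 := (h3' v (by simp)).2 w' (by simp) (by rintro rfl; exact H.irrefl he')
        have : w = w' := Fin.ext (by unfold SamePair at c1 c2; omega)
        exact Subtype.ext (congrArg (fun x => s(v, x)) this)
      · refine h2 (hcol.ne k (mem_range.2 hk) k' (mem_range.2 hk') hkk ?_ (by omega))
        unfold Share
        omega)
  refine ⟨H, C, ⟨hHG, ⟨C⟩, fun H' hH' hc' => ?_⟩, fun i j => ?_⟩
  · obtain ⟨C', h1, h2⟩ := exists_proper hE hH' hc'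
    rw [← h2, ncard_edgeSet_eq hE hHG]
    refine (hmax C' h1).trans (card_le_card fun i hi => ?_)
    rw [mem_filter] at hi ⊢
    have hlt := hE.lt i (mem_range.1 hi.1)
    refine ⟨hi.1, hlt.1, hlt.2.1, ?_⟩
    change σ.M (eu i * n + ev i) ≠ 0
    rw [(hO.edge i (mem_range.1 hi.1)).1]
    exact hi.2
  · rw [hmem]
    split_ifs with h
    · have h1 : ((C ⟨s(i, j), h⟩ : Fin 2) : ℕ) = σ.M ((i : ℕ) * n + j) - 1 := rfl
      have h2 : σ.M ((i : ℕ) * n + j) ≠ 0 := h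
      omega
    · exact not_not.1 h

lemma solvesWithin_solve (hG : G.Connected) :
    SolvesWithin solve G (n * 12 + 4 + (setupTime n (G.edgeSet.ncard + 1 - n) +
      (3 ^ (G.edgeSet.ncard + 1 - n) * (tryTime n G.edgeSet.ncard (n - 1) + 9) + 7))) := by
  obtain ⟨v⟩ := hG.nonempty
  obtain ⟨σ, h1, h2, h3⟩ := exists_eq_toState G
  have hmt : ∀ m t eu ev, EdgeList n (natAdj G) m t eu ev → m = G.edgeSet.ncard ∧ t = n - 1 := by
    intro m t eu ev hE
    exact ⟨hE.card_edges, by have := hE.card; omega⟩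
  have h4 : Runs n (setup ;; search) σ (setupTime n (G.edgeSet.ncard + 1 - n) +
      (3 ^ (G.edgeSet.ncard + 1 - n) * (tryTime n G.edgeSet.ncard (n - 1) + 9) + 7)) fun τ =>
      ∃ (H : SimpleGraph (Fin n)) (C : H.lineGraph.Coloring (Fin 2)),
        IsMaxEdgeColorable G H 2 ∧ Describes (τ.toState n) H C := by
    refine Runs.seq (runs_setup (adj := natAdj G) v.pos (fun u v h => ⟨h.1, h.2.1⟩)
      (fun u hu v hv => by rw [h3]; exact initState_mem_ne_zero hu hv) h2
      (fun w hw => reachIn_of_connected hG hw) (fun m t eu ev hE => ?_)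
      fun τ m t eu ev hE a1 a2 a3 => ?_)
    · obtain ⟨rfl, rfl⟩ := hmt _ _ _ _ hE
      omega
    · refine Runs.mono (runs_search hE a1 a2 a3 fun τ col b1 b2 b3 =>
        exists_describes hE b1 b2 b3) ?_ fun _ h => h
      obtain ⟨rfl, rfl⟩ := hmt _ _ _ _ hE
      rw [show G.edgeSet.ncard + 1 - n = G.edgeSet.ncard - (n - 1) by have := v.pos; omega]
  obtain ⟨τ, t, h5, h6, h7⟩ := h4
  exact ⟨τ.toState n, _, .seq h1 h5, by omega, h7⟩

/-- The polynomial factor of the running time. -/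
noncomputable def solvePoly : Polynomial ℕ :=
  .X * 12 + 4 + (2 + (.X * (50 + 9) + 7) +
    (60 + (.X * (.X * (.X * (500 + 9) + 7 + 9) + 7 + 9) + 7) +
      (.X * (.X * (400 + 9) + 7 + 9) + 7 + 4 + (300 + (.X * (500 + 9) + 7))))) +
    (.X * (4000 + 9) + 7 + (4 + (.X * (3000 + 9) + 7) + (.X * (31000 + 9) + 7 +
    (.X * (13000 + 9) + 7 + (.X * (300 + 9) + 20)))) + 9) + 7

lemma solvesWithin_pow (hG : G.Connected) :
    SolvesWithin solve G (3 ^ (G.edgeSet.ncard + 1 - n) * solvePoly.eval (inputSize n)) := by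
  obtain ⟨s, t, h1, h2, h3⟩ := solvesWithin_solve hG
  refine ⟨s, t, h1, h2.trans ?_, h3⟩
  have hm : G.edgeSet.ncard ≤ n * n := by
    classical
    rw [← SimpleGraph.coe_edgeFinset, Set.ncard_coe_finset]
    refine G.card_edgeFinset_le_card_choose_two.trans ?_
    rw [Fintype.card_fin, Nat.choose_two_right]
    exact (Nat.div_le_self _ _).trans (Nat.mul_le_mul_left _ (Nat.sub_le _ _))
  set S := inputSize n with hS
  have hSn : n ≤ S := by
    rw [hS, inputSize]
    nlinarith
  have hSm : G.edgeSet.ncard ≤ S := by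
    rw [hS, inputSize]
    omega
  set c := G.edgeSet.ncard + 1 - n with hc
  obtain ⟨v⟩ := hG.nonempty
  have hcS : c ≤ S := by
    have := v.pos
    omega
  have hp : 1 ≤ 3 ^ c := Nat.one_le_pow _ _ (by norm_num)
  have hA : n * 12 + 4 + setupTime n c ≤ S * 12 + 4 + setupTime S S := by
    unfold setupTime scanTime
    gcongr
  have hB : tryTime n G.edgeSet.ncard (n - 1) ≤ S * (4000 + 9) + 7 + (4 + (S * (3000 + 9) + 7) +
      (S * (31000 + 9) + 7 + (S * (13000 + 9) + 7 + (S * (300 + 9) + 20)))) := by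
    unfold tryTime
    have h4 : G.edgeSet.ncard - (n - 1) ≤ S := by omega
    have h5 : n - 1 ≤ S := by omega
    gcongr
  have hpoly : solvePoly.eval S = S * 12 + 4 + setupTime S S + (S * (4000 + 9) + 7 +
      (4 + (S * (3000 + 9) + 7) + (S * (31000 + 9) + 7 + (S * (13000 + 9) + 7 +
      (S * (300 + 9) + 20)))) + 9) + 7 := by
    simp [solvePoly, setupTime, scanTime]
  have key : ∀ a b x y z : ℕ, x + y ≤ a → z ≤ b →
      x + (y + (3 ^ c * (z + 9) + 7)) ≤ 3 ^ c * (a + (b + 9) + 7) := by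
    intro a b x y z hx hz
    have h1 := Nat.mul_le_mul_left (3 ^ c) (Nat.add_le_add_right hz 9)
    have h2 := Nat.mul_le_mul_right (a + 7) hp
    nlinarith
  rw [hpoly]
  exact key _ _ _ _ _ hA hB

lemma SolvesWithin.mono {c : Cmd} {T T' : ℕ} (h : SolvesWithin c G T) (hT : T ≤ T') :
    SolvesWithin c G T' := by
  obtain ⟨s, t, h1, h2, h3⟩ := h
  exact ⟨s, t, h1, h2.trans hT, h3⟩

lemma solvableInParamTime_maxLeaf :
    SolvableInParamTime (fun _ G => maxLeaf G) (fun k => 2 ^ ((k + 1) ^ 2)) := by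
  refine ⟨solve, 4 * solvePoly, fun n G hG => (solvesWithin_pow hG).mono ?_⟩
  have h1 : 3 ^ (G.edgeSet.ncard + 1 - n) ≤ 4 * 2 ^ ((maxLeaf G + 1) ^ 2) := by
    calc 3 ^ (G.edgeSet.ncard + 1 - n) ≤ 4 ^ (G.edgeSet.ncard + 1 - n) :=
          Nat.pow_le_pow_left (by norm_num) _
      _ = 2 ^ (2 * (G.edgeSet.ncard + 1 - n)) := by rw [pow_mul]; norm_num
      _ ≤ 2 ^ (2 + (maxLeaf G + 1) ^ 2) := by
          refine Nat.pow_le_pow_right (by norm_num) ?_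
          have := two_mul_card_edges_lt hG
          omega
      _ = 4 * 2 ^ ((maxLeaf G + 1) ^ 2) := by rw [pow_add]; norm_num
  simp only [Polynomial.eval_mul, Polynomial.eval_ofNat]
  nlinarith [Nat.mul_le_mul_right (solvePoly.eval (inputSize n)) h1]

lemma two_pow_le_card (hn : 0 < n)
    (h : (G.edgeSet.ncard : ℝ) ≤ (n : ℝ) + Real.logb 2 (n : ℝ)) :
    2 ^ (G.edgeSet.ncard - n) ≤ n := by
  rcases Nat.lt_or_ge G.edgeSet.ncard n with hlt | hge
  · rw [Nat.sub_eq_zero_of_le hlt.le, pow_zero]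
    exact hn
  · have hn' : (0 : ℝ) < n := by exact_mod_cast hn
    have h1 : ((G.edgeSet.ncard - n : ℕ) : ℝ) ≤ Real.logb 2 (n : ℝ) := by
      rw [Nat.cast_sub hge]
      linarith
    rw [Real.le_logb_iff_rpow_le one_lt_two hn', Real.rpow_natCast] at h1
    exact_mod_cast h1

lemma solvableInPolyTime_sparse : SolvableInPolyTime (fun n G =>
    G.Connected ∧ (G.edgeSet.ncard : ℝ) ≤ (n : ℝ) + Real.logb 2 (n : ℝ)) := by
  refine ⟨solve, 4 * .X * solvePoly, fun n G ⟨hG, h⟩ => (solvesWithin_pow hG).mono ?_⟩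
  obtain ⟨v⟩ := hG.nonempty
  have h1 : 3 ^ (G.edgeSet.ncard + 1 - n) ≤ 4 * inputSize n := by
    calc 3 ^ (G.edgeSet.ncard + 1 - n) ≤ 4 ^ (G.edgeSet.ncard + 1 - n) :=
          Nat.pow_le_pow_left (by norm_num) _
      _ ≤ 4 ^ (G.edgeSet.ncard - n + 1) := Nat.pow_le_pow_right (by norm_num) (by omega)
      _ = 4 * (2 ^ (G.edgeSet.ncard - n)) ^ 2 := by
          rw [pow_succ, ← pow_mul, mul_comm _ 2, pow_mul]
          norm_num [mul_comm]
      _ ≤ 4 * inputSize n := by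
          have := Nat.pow_le_pow_left (two_pow_le_card v.pos h) 2
          unfold inputSize
          nlinarith
  simp only [Polynomial.eval_mul, Polynomial.eval_ofNat, Polynomial.eval_X]
  exact Nat.mul_le_mul_right _ h1

lemma computable_two_pow_sq : Computable fun k : ℕ => 2 ^ ((k + 1) ^ 2) := by
  have h1 : Primrec fun k : ℕ => 2 ^ k :=
    (Primrec.nat_rec₁ 1 (Primrec.nat_mul.comp (Primrec.const 2) Primrec.snd).to₂).of_eq
      fun k => by
        induction k with
        | zero => rfl
        | succ k ih => exact (congrArg (2 * ·) ih).trans (pow_succ' 2 k).symm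
  have h2 : Primrec fun k : ℕ => (k + 1) * (k + 1) :=
    Primrec.nat_mul.comp Primrec.succ Primrec.succ
  exact ((h1.comp h2).of_eq fun k => by rw [sq]).to_comp

end

end MaxTwoEdgeCol

theorem mainTheorem10 :
    MaxTwoEdgeCol.IsFPT (fun _ G => MaxTwoEdgeCol.maxLeaf G) ∧
    MaxTwoEdgeCol.SolvableInParamTime (fun _ G => MaxTwoEdgeCol.maxLeaf G)
      (fun k => 2 ^ ((k + 1) ^ 2)) ∧
    MaxTwoEdgeCol.SolvableInPolyTime (fun n G =>
      G.Connected ∧ (G.edgeSet.ncard : ℝ) ≤ (n : ℝ) + Real.logb 2 (n : ℝ)) ∧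
    ∀ (n : ℕ) (G : SimpleGraph (Fin n)), G.Connected →
      (n : ℝ) + Real.logb 2 (n : ℝ) < (G.edgeSet.ncard : ℝ) →
      (n : ℝ) < (2 : ℝ) ^ (((MaxTwoEdgeCol.maxLeaf G : ℝ) + 1) ^ 2 / 2) :=
  ⟨⟨_, MaxTwoEdgeCol.computable_two_pow_sq, MaxTwoEdgeCol.solvableInParamTime_maxLeaf⟩,
    MaxTwoEdgeCol.solvableInParamTime_maxLeaf, MaxTwoEdgeCol.solvableInPolyTime_sparse,
    fun _ _ hG h => MaxTwoEdgeCol.card_lt_two_rpow hG h⟩
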